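/- Let $d\ge 0$, let $\mu_1,\dots,\mu_m\in\mathbb R^d$ satisfy $\|\mu_i\|\le D$ for all $i$, let $w_1,\dots,w_m>0$ with $\sum_{i=1}^m w_i=1$, and let $$f(x)=-\ln\Big(\sum_{i=1}^m w_i\,e^{-\|x-\mu_i\|^2/2}\Big),\qquad x\in\mathbb R^d .$$ Call $h:\mathbb R^d\to\mathbb R$ $\alpha$-strongly convex if $h(tx+(1-t)y)\le t\,h(x)+(1-t)\,h(y)-\tfrac{\alpha}{2}t(1-t)\|x-y\|^2$ for all $x,y\in\mathbb R^d$ and $t\in[0,1]$. (1) The $\tfrac12$-strongly convex envelope of $f$, $$g(x)=\sup\{h(x)\;:\;h:\mathbb R^d\to\mathbb R\ \text{is }\tfrac12\text{-strongly convex and } h\le f\},$$ is finite at every $x\in\mathbb R^d$, is $\tfrac12$-strongly convex, and satisfies $|f(x)-g(x)|\le D^2$ for all $x\in\mathbb R^d$. (2) For every $\beta>0$, the Langevin diffusion $dX_t=-\beta\nabla f(X_t)\,dt+\sqrt2\,dW_t$ satisfies a Poincaré inequality with constant $C=16e^{2\beta D^2}/\beta$. That is, $e^{-\beta f}$ is integrable,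 and, with $p$ the (stationary) probability measure on $\mathbb R^d$ with density proportional to $e^{-\beta f}$, $$\int_{\mathbb R^d}\|\nabla u\|^2\,dp\;\ge\;\frac1C\,\operatorname{Var}_p(u)$$ for every $u\in L^2(p)$ with weak gradient $\nabla u\in L^2(p)$. -/

import Mathlib

open MeasureTheory
open scoped ContDiff

noncomputable section

/-- The potential `f(x) = -ln (∑ i, w i * exp (-‖x - μ i‖² / 2))` of a mixture of Gaussians with
identity covariance, weights `w` and means `μ`. -/
def mixturePotential {d m : ℕ} (w : Fin m → ℝ) (μ : Fin m → EuclideanSpace ℝ (Fin d))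
    (x : EuclideanSpace ℝ (Fin d)) : ℝ :=
  -Real.log (∑ i, w i * Real.exp (-(‖x - μ i‖ ^ 2 / 2)))

/-- The `α`-strongly convex envelope of a real-valued function `f`: the pointwise supremum of all
`α`-strongly convex functions below `f`. The supremum is taken in the extended reals, so that it is
`⊥` if there is no such function. `StrongConvexOn Set.univ α h` says
`h (a x + b y) ≤ a h x + b h y - a b (α / 2) ‖x - y‖²` for `a, b ≥ 0`, `a + b = 1`. -/
def stronglyConvexEnvelope {d : ℕ} (α : ℝ) (f : EuclideanSpace ℝ (Fin d) → ℝ)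
    (x : EuclideanSpace ℝ (Fin d)) : EReal :=
  ⨆ h ∈ {h : EuclideanSpace ℝ (Fin d) → ℝ | StrongConvexOn Set.univ α h ∧ ∀ y, h y ≤ f y},
    (h x : EReal)

/-- The stationary distribution of the Langevin diffusion `dX = -∇V(X) dt + √2 dW`: the probability
measure with Lebesgue density proportional to `exp (-V)`. -/
def langevinStationary {d : ℕ} (V : EuclideanSpace ℝ (Fin d) → ℝ) :
    Measure (EuclideanSpace ℝ (Fin d)) :=
  (volume : Measure (EuclideanSpace ℝ (Fin d))).tilted (fun x => -V x)

/-- `G` is the weak (distributional) gradient of `g` on `ℝ^d`. -/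
structure HasWeakGradient {d : ℕ} (g : EuclideanSpace ℝ (Fin d) → ℝ)
    (G : EuclideanSpace ℝ (Fin d) → EuclideanSpace ℝ (Fin d)) : Prop where
  locallyIntegrable : LocallyIntegrable g volume
  locallyIntegrable_gradient : LocallyIntegrable G volume
  integral_eq : ∀ φ : EuclideanSpace ℝ (Fin d) → ℝ, ContDiff ℝ ∞ φ → HasCompactSupport φ →
    ∀ v : EuclideanSpace ℝ (Fin d),
      ∫ x, g x * fderiv ℝ φ x v = -∫ x, φ x * inner ℝ (G x) v

/-- Langevin diffusion on the potential `V` satisfies a Poincaré inequality with constant `C`: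
`exp (-V)` can be normalized to a probability measure `p`, and the Dirichlet form
`∫ ‖∇g‖² dp` of the diffusion is at least `(1 / C) Var_p(g)` for every `g` in the domain of the
form, the weighted Sobolev space of all `g ∈ L²(p)` with weak gradient in `L²(p)`. -/
structure LangevinPoincare {d : ℕ} (V : EuclideanSpace ℝ (Fin d) → ℝ) (C : ℝ) : Prop where
  isProbabilityMeasure : IsProbabilityMeasure (langevinStationary V)
  pos : 0 < C
  poincare : ∀ (g : EuclideanSpace ℝ (Fin d) → ℝ)
    (G : EuclideanSpace ℝ (Fin d) → EuclideanSpace ℝ (Fin d)),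
    MemLp g 2 (langevinStationary V) → HasWeakGradient g G →
    MemLp G 2 (langevinStationary V) →
      (1 / C) * ProbabilityTheory.variance g (langevinStationary V) ≤
        ∫ x, ‖G x‖ ^ 2 ∂(langevinStationary V)

end

/-! Completing the square gives `f x = ‖x‖²/2 - ψ x`, where `ψ` is the logarithm of a moment
generating function. Its subgradients are weighted means of the `μ i`, hence have norm at most `D`.
Write `ψ` as the supremum of its affine minorants `⟪x, p⟫ - c` with `‖p‖ ≤ D`, and subtract the
penalty `‖p‖²` inside the supremum. This lowers `ψ` by at most `D²`, and `‖x‖²/4 - ⟪x, p⟫ + ‖p‖² + c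
= ‖x/2 - p‖² + c` is jointly convex in `(x, p, c)`. Its infimum over `(p, c)` is therefore convex in
`x`; the other `‖x‖²/4` makes the result `1/2`-strongly convex. After subtracting `D²` it is a
minorant of `f` within `D²` of it, and the envelope lies between this minorant and `f`.

So `β f` is within `δ = β D²` of a `c = β/2`-strongly convex function. The Poincaré inequality for a
`c`-strongly convex potential comes from linearizing the Prékopa–Leindler inequality
(`poincare_of_strongConvexOn`), for test functions and with constant `2/c`. The variance is half of
`∬ (φ x - φ y)²`, which is monotone in the measure, so the perturbation costs only `exp (2δ)`, as in
Holley–Stroock (`poincare_of_perturbation`).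

Weakly differentiable functions are reached by cutoff and mollification
(`HasWeakGradient.exists_approximation`). Fatou's lemma needs only almost everywhere convergence and
an energy bound, here with a loss of `4`. Altogether the constant is `4 · (2/c) exp (2δ) = 16 exp
(2βD²)/β`. -/

/-! ### The strongly convex envelope of the mixture potential. -/

/-- A family of affine minorants with slopes in a ball makes `‖x‖²/2 - ψ` almost `1/2`-strongly
convex. -/
theorem exists_strongConvexOn_half_of_subgradient {E : Type*} [NormedAddCommGroup E]
    [InnerProductSpace ℝ E] {ψ : E → ℝ} {D : ℝ}
    (hψ : ∀ x, ∃ p : E, ‖p‖ ≤ D ∧ ∀ y, ψ x + inner ℝ (y - x) p ≤ ψ y) :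
    ∃ g : E → ℝ, StrongConvexOn Set.univ (1 / 2) g ∧
      ∀ x, g x ≤ ‖x‖ ^ 2 / 2 - ψ x ∧ ‖x‖ ^ 2 / 2 - ψ x - D ^ 2 ≤ g x := by
  let S : Set (E × ℝ) := {e | ‖e.1‖ ≤ D ∧ ∀ y, inner ℝ y e.1 - e.2 ≤ ψ y}
  have hexp : ∀ x p : E, ‖(1 / 2 : ℝ) • x - p‖ ^ 2 = ‖x‖ ^ 2 / 4 - inner ℝ x p + ‖p‖ ^ 2 := by
    intro x p
    rw [norm_sub_sq_real, norm_smul, real_inner_smul_left]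
    norm_num
    ring
  -- The term `‖p‖²`, between `0` and `D²`, completes the square. This is what makes `Φ` jointly
  -- convex in the point and the minorant.
  let Φ : E → S → ℝ := fun x e => ‖(1 / 2 : ℝ) • x - e.1.1‖ ^ 2 + e.1.2
  have hlow : ∀ x (e : S), ‖x‖ ^ 2 / 4 - ψ x ≤ Φ x e := by
    intro x e
    have := e.2.2 x
    simp only [Φ, hexp]
    nlinarith [sq_nonneg ‖e.1.1‖]
  have hbdd : ∀ x, BddBelow (Set.range (Φ x)) := by
    intro x
    refine ⟨‖x‖ ^ 2 / 4 - ψ x, ?_⟩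
    rintro _ ⟨e, rfl⟩
    exact hlow x e
  have hup : ∀ x, ∃ e : S, Φ x e ≤ ‖x‖ ^ 2 / 4 - ψ x + D ^ 2 := by
    intro x
    obtain ⟨p, hp, h⟩ := hψ x
    refine ⟨⟨(p, inner ℝ x p - ψ x), hp, fun y => ?_⟩, ?_⟩
    · have := h y
      rw [inner_sub_left] at this
      simp only
      linarith
    · simp only [Φ, hexp]
      have : ‖p‖ ^ 2 ≤ D ^ 2 := by gcongr
      linarith
  have : Nonempty S := ⟨(hup 0).choose⟩
  let k : E → ℝ := fun x => ⨅ e, Φ x e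
  have hk : ConvexOn ℝ Set.univ k := by
    refine ⟨convex_univ, fun x _ y _ a b ha hb hab => ?_⟩
    refine le_of_forall_pos_le_add fun δ hδ => ?_
    -- Partial minimization of a jointly convex function over a convex set; near-minimizers avoid
    -- having to attain the infimum.
    obtain ⟨e₁, h₁⟩ := exists_lt_of_ciInf_lt (show k x < k x + δ by linarith)
    obtain ⟨e₂, h₂⟩ := exists_lt_of_ciInf_lt (show k y < k y + δ by linarith)
    have hmem : a • e₁.1 + b • e₂.1 ∈ S := by
      refine ⟨?_, fun z => ?_⟩
      · calc ‖a • e₁.1.1 + b • e₂.1.1‖ ≤ a * ‖e₁.1.1‖ + b * ‖e₂.1.1‖ := by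
              refine (norm_add_le _ _).trans ?_
              rw [norm_smul, norm_smul, Real.norm_of_nonneg ha, Real.norm_of_nonneg hb]
          _ ≤ a * D + b * D := by gcongr; exacts [e₁.2.1, e₂.2.1]
          _ = D := by rw [← add_mul, hab, one_mul]
      · have h1 := e₁.2.2 z
        have h2 := e₂.2.2 z
        simp only [Prod.fst_add, Prod.snd_add, Prod.smul_fst, Prod.smul_snd, inner_add_right,
          real_inner_smul_right, smul_eq_mul]
        calc _ = a * (inner ℝ z e₁.1.1 - e₁.1.2) + b * (inner ℝ z e₂.1.1 - e₂.1.2) := by ring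
          _ ≤ a * ψ z + b * ψ z := by gcongr
          _ = ψ z := by rw [← add_mul, hab, one_mul]
    have hle : k (a • x + b • y) ≤ Φ (a • x + b • y) ⟨_, hmem⟩ := ciInf_le (hbdd _) _
    have hconv : Φ (a • x + b • y) ⟨_, hmem⟩ ≤ a * Φ x e₁ + b * Φ y e₂ := by
      have hn : ‖(1 / 2 : ℝ) • (a • x + b • y) - (a • e₁.1.1 + b • e₂.1.1)‖ ≤
          a * ‖(1 / 2 : ℝ) • x - e₁.1.1‖ + b * ‖(1 / 2 : ℝ) • y - e₂.1.1‖ := by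
        have : (1 / 2 : ℝ) • (a • x + b • y) - (a • e₁.1.1 + b • e₂.1.1) =
            a • ((1 / 2 : ℝ) • x - e₁.1.1) + b • ((1 / 2 : ℝ) • y - e₂.1.1) := by module
        rw [this]
        refine (norm_add_le _ _).trans ?_
        rw [norm_smul, norm_smul, Real.norm_of_nonneg ha, Real.norm_of_nonneg hb]
      have hsq := (convexOn_pow (𝕜 := ℝ) 2).2 (norm_nonneg ((1 / 2 : ℝ) • x - e₁.1.1))
        (norm_nonneg ((1 / 2 : ℝ) • y - e₂.1.1)) ha hb hab
      simp only [smul_eq_mul] at hsq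
      have := (pow_le_pow_left₀ (norm_nonneg _) hn 2).trans hsq
      simp only [Φ, Prod.fst_add, Prod.snd_add, Prod.smul_fst, Prod.smul_snd, smul_eq_mul]
      linarith
    simp only [smul_eq_mul]
    nlinarith [mul_le_mul_of_nonneg_left h₁.le ha, mul_le_mul_of_nonneg_left h₂.le hb]
  refine ⟨fun x => k x + (‖x‖ ^ 2 / 4 - D ^ 2), ?_, fun x => ⟨?_, ?_⟩⟩
  · rw [strongConvexOn_iff_convex]
    refine (hk.add_const (-D ^ 2)).congr fun x _ => ?_
    simp only [Pi.add_apply]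
    ring
  · obtain ⟨e, he⟩ := hup x
    have : k x ≤ Φ x e := ciInf_le (hbdd x) e
    simp only
    linarith
  · have : ‖x‖ ^ 2 / 4 - ψ x ≤ k x := le_ciInf (hlow x)
    simp only
    linarith

/-- The logarithmic moment generating function has a subgradient in the ball containing the
points. -/
theorem exists_subgradient_log_sum_exp {E ι : Type*} [NormedAddCommGroup E]
    [InnerProductSpace ℝ E] [Fintype ι] [Nonempty ι] {c : ι → ℝ} {μ : ι → E} {D : ℝ}
    (hc : ∀ i, 0 < c i) (hμ : ∀ i, ‖μ i‖ ≤ D) (x : E) :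
    ∃ p : E, ‖p‖ ≤ D ∧ ∀ y, Real.log (∑ i, c i * Real.exp (inner ℝ x (μ i))) + inner ℝ (y - x) p ≤
      Real.log (∑ i, c i * Real.exp (inner ℝ y (μ i))) := by
  have hpos : ∀ y : E, 0 < ∑ i, c i * Real.exp (inner ℝ y (μ i)) := fun y =>
    Finset.sum_pos (fun i _ => mul_pos (hc i) (Real.exp_pos _)) Finset.univ_nonempty
  set s := ∑ i, c i * Real.exp (inner ℝ x (μ i)) with hs
  -- The exponentially tilted weights at `x`; the mean `∑ q i • μ i` is the gradient there. The
  -- subgradient inequality is Jensen for `exp` under these weights.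
  let q : ι → ℝ := fun i => c i * Real.exp (inner ℝ x (μ i)) / s
  have hq : ∀ i, 0 ≤ q i := fun i =>
    div_nonneg (mul_pos (hc i) (Real.exp_pos _)).le (hpos x).le
  have hq1 : ∑ i, q i = 1 := by
    simp only [q, ← Finset.sum_div]
    exact div_self (hpos x).ne'
  refine ⟨∑ i, q i • μ i, ?_, fun y => ?_⟩
  · calc ‖∑ i, q i • μ i‖ ≤ ∑ i, q i * D := by
          refine norm_sum_le_of_le _ fun i _ => ?_
          rw [norm_smul, Real.norm_of_nonneg (hq i)]
          exact mul_le_mul_of_nonneg_left (hμ i) (hq i)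
      _ = D := by rw [← Finset.sum_mul, hq1, one_mul]
  · rw [Real.le_log_iff_exp_le (hpos y), Real.exp_add, Real.exp_log (hpos x)]
    have hj := convexOn_exp.map_sum_le (t := Finset.univ) (w := q)
      (p := fun i => inner ℝ (y - x) (μ i)) (fun i _ => hq i) hq1 (fun i _ => Set.mem_univ _)
    simp only [smul_eq_mul] at hj
    have : inner ℝ (y - x) (∑ i, q i • μ i) = ∑ i, q i * inner ℝ (y - x) (μ i) := by
      rw [inner_sum]
      simp only [real_inner_smul_right]
    rw [this]
    refine (mul_le_mul_of_nonneg_left hj (hpos x).le).trans_eq ?_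
    rw [Finset.mul_sum]
    refine Finset.sum_congr rfl fun i _ => ?_
    simp only [q, inner_sub_left, Real.exp_sub]
    rw [← hs]
    have : s ≠ 0 := (hpos x).ne'
    field_simp

theorem mixturePotential_eq {d m : ℕ} (w : Fin m → ℝ) (μ : Fin m → EuclideanSpace ℝ (Fin d))
    (hw : ∀ i, 0 < w i) [Nonempty (Fin m)] (x : EuclideanSpace ℝ (Fin d)) :
    mixturePotential w μ x = ‖x‖ ^ 2 / 2 -
      Real.log (∑ i, w i * Real.exp (-(‖μ i‖ ^ 2 / 2)) * Real.exp (inner ℝ x (μ i))) := by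
  have : ∑ i, w i * Real.exp (-(‖x - μ i‖ ^ 2 / 2)) = Real.exp (-(‖x‖ ^ 2 / 2)) *
      ∑ i, w i * Real.exp (-(‖μ i‖ ^ 2 / 2)) * Real.exp (inner ℝ x (μ i)) := by
    rw [Finset.mul_sum]
    refine Finset.sum_congr rfl fun i _ => ?_
    rw [norm_sub_sq_real, mul_assoc, ← Real.exp_add, mul_left_comm, ← Real.exp_add]
    ring_nf
  rw [mixturePotential, this, Real.log_mul (Real.exp_pos _).ne', Real.log_exp]
  · ring
  · exact (Finset.sum_pos (fun i _ => mul_pos (mul_pos (hw i) (Real.exp_pos _)) (Real.exp_pos _))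
      Finset.univ_nonempty).ne'

/-- The strongly convex envelope is real-valued and strongly convex as soon as the function has
one strongly convex minorant. -/
theorem exists_stronglyConvexEnvelope_eq {d : ℕ} {α : ℝ} {f g₀ : EuclideanSpace ℝ (Fin d) → ℝ}
    (hg₀ : StrongConvexOn Set.univ α g₀) (hle : ∀ x, g₀ x ≤ f x) :
    ∃ g : EuclideanSpace ℝ (Fin d) → ℝ,
      (∀ x, stronglyConvexEnvelope α f x = (g x : EReal)) ∧
      StrongConvexOn Set.univ α g ∧ ∀ x, g₀ x ≤ g x ∧ g x ≤ f x := by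
  have hlow : ∀ x, (g₀ x : EReal) ≤ stronglyConvexEnvelope α f x := fun x =>
    le_iSup₂_of_le (f := fun (h : EuclideanSpace ℝ (Fin d) → ℝ) _ => (h x : EReal)) g₀
      ⟨hg₀, hle⟩ le_rfl
  have hup : ∀ x, stronglyConvexEnvelope α f x ≤ (f x : EReal) := fun x =>
    iSup₂_le fun h hh => EReal.coe_le_coe_iff.2 (hh.2 x)
  let g := fun x => (stronglyConvexEnvelope α f x).toReal
  have hg : ∀ x, stronglyConvexEnvelope α f x = (g x : EReal) := fun x =>
    (EReal.coe_toReal ((hup x).trans_lt (EReal.coe_lt_top _)).ne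
      ((EReal.bot_lt_coe _).trans_le (hlow x)).ne').symm
  refine ⟨g, hg, ⟨convex_univ, fun x _ y _ a b ha hb hab => ?_⟩, fun x => ⟨?_, ?_⟩⟩
  -- A supremum of strongly convex functions is strongly convex: bound each competitor `h` at `a • x
  -- + b • y`, then replace `h` by `g` on the right.
  · rw [← EReal.coe_le_coe_iff, ← hg]
    refine iSup₂_le fun h hh => EReal.coe_le_coe_iff.2 ?_
    have hhg : ∀ z, h z ≤ g z := fun z => by
      rw [← EReal.coe_le_coe_iff, ← hg]
      exact le_iSup₂_of_le (f := fun (h : EuclideanSpace ℝ (Fin d) → ℝ) _ => (h z : EReal)) h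
        hh le_rfl
    refine (hh.1.2 (Set.mem_univ x) (Set.mem_univ y) ha hb hab).trans ?_
    simp only [smul_eq_mul]
    gcongr <;> exact hhg _
  · rw [← EReal.coe_le_coe_iff, ← hg]
    exact hlow x
  · rw [← EReal.coe_le_coe_iff, ← hg]
    exact hup x

theorem exists_mixturePotential_envelope {d m : ℕ} {w : Fin m → ℝ}
    {μ : Fin m → EuclideanSpace ℝ (Fin d)} {D : ℝ} [Nonempty (Fin m)]
    (hw : ∀ i, 0 < w i) (hμ : ∀ i, ‖μ i‖ ≤ D) :
    ∃ g : EuclideanSpace ℝ (Fin d) → ℝ,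
      (∀ x, stronglyConvexEnvelope (1 / 2) (mixturePotential w μ) x = (g x : EReal)) ∧
      StrongConvexOn Set.univ (1 / 2) g ∧
      ∀ x, g x ≤ mixturePotential w μ x ∧ mixturePotential w μ x ≤ g x + D ^ 2 := by
  obtain ⟨g₀, hg₀, h⟩ := exists_strongConvexOn_half_of_subgradient
    (exists_subgradient_log_sum_exp (c := fun i => w i * Real.exp (-(‖μ i‖ ^ 2 / 2)))
      (fun i => mul_pos (hw i) (Real.exp_pos _)) hμ)
  replace h := fun x => (mixturePotential_eq w μ hw x).symm ▸ h x
  obtain ⟨g, h₁, h₂, h₃⟩ := exists_stronglyConvexEnvelope_eq hg₀ fun x => (h x).1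
  exact ⟨g, h₁, h₂, fun x => ⟨(h₃ x).2, by linarith [(h x).2, (h₃ x).1]⟩⟩

/-! ### The midpoint Prékopa–Leindler inequality. -/

/-- One-dimensional Brunn–Minkowski inequality for measurable sets. -/
theorem volume_add_volume_le_of_forall_add_mem {A B S : Set ℝ} (hA : MeasurableSet A)
    (hB : MeasurableSet B) (hA₀ : A.Nonempty) (hB₀ : B.Nonempty)
    (h : ∀ a ∈ A, ∀ b ∈ B, a + b ∈ S) : volume A + volume B ≤ volume S := by
  obtain ⟨a₀, ha₀⟩ := hA₀
  obtain ⟨b₀, hb₀⟩ := hB₀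
  have key : ∀ K ⊆ A, ∀ L ⊆ B, IsCompact K → IsCompact L → K.Nonempty → L.Nonempty →
      volume K + volume L ≤ volume S := by
    intro K hK L hL hKc hLc hK₀ hL₀
    have hM := hKc.sSup_mem hK₀
    have hm := hLc.sInf_mem hL₀
    set M := sSup K
    set m := sInf L
    -- The translates `K + min L` and `max K + L` both lie in `K + L` and meet at most in the single
    -- point `M + m`.
    have h₁ : volume ((fun x => x + -m) ⁻¹' K) = volume K := measure_preimage_add_right _ _ _
    have h₂ : volume ((fun x => x + -M) ⁻¹' L) = volume L := measure_preimage_add_right _ _ _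
    rw [← h₁, ← h₂, ← measure_union₀]
    · refine measure_mono ?_
      rintro x (hx | hx)
      · have := h _ (hK hx) _ (hL hm)
        simpa using this
      · have := h _ (hK hM) _ (hL hx)
        simpa using this
    · exact (measurable_add_const _ hLc.measurableSet).nullMeasurableSet
    · refine measure_mono_null (t := {M + m}) ?_ (by simp)
      rintro x ⟨hx, hx'⟩
      have h1 : x + -m ≤ M := le_csSup hKc.bddAbove hx
      have h2 : m ≤ x + -M := csInf_le hLc.bddBelow hx'
      exact Set.mem_singleton_iff.2 (by linarith)
  rw [hA.measure_eq_iSup_isCompact, hB.measure_eq_iSup_isCompact]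
  simp only [iSup_and']
  refine ENNReal.biSup_add_biSup_le' ⟨∅, by simp⟩ ⟨∅, by simp⟩ fun K hK L hL => ?_
  -- Inner regularity also runs over empty compact sets; adding one point makes them nonempty.
  refine le_trans ?_ (key (insert a₀ K) (Set.insert_subset ha₀ hK.1) (insert b₀ L)
    (Set.insert_subset hb₀ hL.1) (hK.2.insert _) (hL.2.insert _) (Set.insert_nonempty _ _)
    (Set.insert_nonempty _ _))
  gcongr <;> exact Set.subset_insert _ _

theorem lintegral_min_one_eq_lintegral_meas_lt {α : Type*} [MeasurableSpace α] (μ : Measure α)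
    {f : α → ENNReal} (hf : Measurable f) :
    ∫⁻ x, min (f x) 1 ∂μ = ∫⁻ t in Set.Ioo (0 : ℝ) 1, μ {x | ENNReal.ofReal t < f x} := by
  have hne : ∀ x, min (f x) 1 ≠ ⊤ := fun x => ((min_le_right _ _).trans_lt ENNReal.one_lt_top).ne
  have h₁ : ∀ x, min (f x) 1 = ENNReal.ofReal (min (f x) 1).toReal := fun x =>
    (ENNReal.ofReal_toReal (hne x)).symm
  rw [lintegral_congr h₁, lintegral_eq_lintegral_meas_lt μ (ae_of_all _ fun x =>
    ENNReal.toReal_nonneg) (hf.min measurable_const).ennreal_toReal.aemeasurable]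
  have hset : ∀ t : ℝ, 0 ≤ t → {x | t < (min (f x) 1).toReal} =
      {x | ENNReal.ofReal t < f x ∧ t < 1} := by
    intro t ht
    ext x
    simp only [Set.mem_ofPred_eq]
    rw [← ENNReal.ofReal_lt_iff_lt_toReal ht (hne x), lt_min_iff, ENNReal.ofReal_lt_one]
  rw [← lintegral_indicator measurableSet_Ioi, ← lintegral_indicator measurableSet_Ioo]
  refine lintegral_congr fun t => ?_
  by_cases h0 : 0 < t
  · by_cases h1 : t < 1 <;> simp [Set.indicator, h0, h1, hset t h0.le]
  · simp [Set.indicator, h0]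

/-- Once both functions have supremum `1`, all superlevel sets at heights `t < 1` are nonempty. Half
the sum of those of `f` and `g` lies in that of `h`, so Brunn–Minkowski applies at every height, and
integrating over `t` gives an additive form. -/
theorem prekopa_leindler_real_aux {f g h : ℝ → ENNReal} (hf : Measurable f) (hg : Measurable g)
    (hh : Measurable h) (hf1 : ∀ x, f x ≤ 1) (hg1 : ∀ x, g x ≤ 1)
    (hf0 : ∀ t < 1, ∃ x, t < f x) (hg0 : ∀ t < 1, ∃ x, t < g x)
    (hfgh : ∀ x y t, t < f x → t < g y → t < h ((1 / 2 : ℝ) • (x + y))) :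
    (∫⁻ x, f x) + ∫⁻ x, g x ≤ 2 * ∫⁻ x, h x := by
  have e₁ : ∫⁻ x, f x = ∫⁻ x, min (f x) 1 := lintegral_congr fun x => (min_eq_left (hf1 x)).symm
  have e₂ : ∫⁻ x, g x = ∫⁻ x, min (g x) 1 := lintegral_congr fun x => (min_eq_left (hg1 x)).symm
  have e₃ : ∫⁻ x, min (h x) 1 ≤ ∫⁻ x, h x := lintegral_mono fun x => min_le_left _ _
  refine le_trans ?_ (mul_le_mul_right e₃ 2)
  rw [e₁, e₂, lintegral_min_one_eq_lintegral_meas_lt _ hf,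
    lintegral_min_one_eq_lintegral_meas_lt _ hg, lintegral_min_one_eq_lintegral_meas_lt _ hh,
    ← lintegral_const_mul' _ _ (by simp), ← lintegral_add_left']
  · refine lintegral_mono_ae ((ae_restrict_iff' measurableSet_Ioo).2 (ae_of_all _ fun t ht => ?_))
    have ht1 : ENNReal.ofReal t < 1 := ENNReal.ofReal_lt_one.2 ht.2
    refine (volume_add_volume_le_of_forall_add_mem (S := (fun x => (1 / 2 : ℝ) * x) ⁻¹'
      {x | ENNReal.ofReal t < h x}) (measurableSet_lt measurable_const hf)
      (measurableSet_lt measurable_const hg) (hf0 _ ht1) (hg0 _ ht1) ?_).trans_eq ?_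
    · exact fun a ha b hb => hfgh a b _ ha hb
    · rw [Real.volume_preimage_mul_left (by norm_num)]
      norm_num
  · refine Antitone.measurable (fun s t hst => measure_mono fun x hx => ?_) |>.aemeasurable
    exact (ENNReal.ofReal_le_ofReal hst).trans_lt hx

/-- The midpoint Prékopa–Leindler inequality holds on the space `E`. -/
def HasMidpointPrekopaLeindler (E : Type*) [AddCommGroup E] [Module ℝ E] [MeasureSpace E] : Prop :=
  ∀ f g h : E → ENNReal, Measurable f → Measurable g → Measurable h →
    (∀ x y, f x * g y ≤ h ((1 / 2 : ℝ) • (x + y)) ^ 2) →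
    (∫⁻ x, f x) * ∫⁻ x, g x ≤ (∫⁻ x, h x) ^ 2

theorem prekopa_leindler_real_of_bounded {f g h : ℝ → ENNReal} (hf : Measurable f)
    (hg : Measurable g) (hh : Measurable h) (hfb : ⨆ x, f x ≠ ⊤) (hgb : ⨆ x, g x ≠ ⊤)
    (hfgh : ∀ x y, f x * g y ≤ h ((1 / 2 : ℝ) • (x + y)) ^ 2) :
    (∫⁻ x, f x) * ∫⁻ x, g x ≤ (∫⁻ x, h x) ^ 2 := by
  set F := ⨆ x, f x with hF
  set G := ⨆ x, g x with hG
  rcases eq_or_ne F 0 with hF0 | hF0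
  · have : ∀ x, f x = 0 := fun x => le_antisymm (hF0 ▸ le_iSup f x) zero_le
    simp [this]
  rcases eq_or_ne G 0 with hG0 | hG0
  · have : ∀ x, g x = 0 := fun x => le_antisymm (hG0 ▸ le_iSup g x) zero_le
    simp [this]
  -- Dividing `f`, `g`, `h` by `F`, `G`, `√(FG)` preserves the midpoint hypothesis. The
  -- arithmetic–geometric mean inequality then turns the additive form into the product form.
  set s := (F * G) ^ (1 / 2 : ℝ) with hs
  have hFG0 : F * G ≠ 0 := mul_ne_zero hF0 hG0
  have hFGt : F * G ≠ ⊤ := ENNReal.mul_ne_top hfb hgb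
  have hs2 : s ^ 2 = F * G := by
    rw [hs, ← ENNReal.rpow_natCast, ← ENNReal.rpow_mul]
    norm_num
  have hs0 : s ≠ 0 := fun h0 => hFG0 (by rw [← hs2, h0]; simp)
  have hst : s ≠ ⊤ := fun h0 => hFGt (by rw [← hs2, h0]; simp)
  have hlev : ∀ (u : ℝ → ENNReal) (U : ENNReal), U = ⨆ x, u x → U ≠ 0 → U ≠ ⊤ →
      ∀ t < 1, ∃ x, t < u x / U := by
    intro u U hU hU0 hUt t ht
    have : t * U < ⨆ x, u x := by
      rw [← hU]
      simpa using ENNReal.mul_lt_mul_left hU0 hUt ht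
    obtain ⟨x, hx⟩ := lt_iSup_iff.1 this
    exact ⟨x, (ENNReal.lt_div_iff_mul_lt (.inl hU0) (.inl hUt)).2 hx⟩
  have key := prekopa_leindler_real_aux (f := fun x => f x / F) (g := fun x => g x / G)
    (h := fun x => h x / s) (hf.div_const F) (hg.div_const G) (hh.div_const s)
    (fun x => ENNReal.div_le_of_le_mul (by simpa using le_iSup f x))
    (fun x => ENNReal.div_le_of_le_mul (by simpa using le_iSup g x))
    (hlev f F hF hF0 hfb) (hlev g G hG hG0 hgb) (fun x y t hx hy => by
      rw [ENNReal.lt_div_iff_mul_lt (.inl hF0) (.inl hfb)] at hx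
      rw [ENNReal.lt_div_iff_mul_lt (.inl hG0) (.inl hgb)] at hy
      rw [ENNReal.lt_div_iff_mul_lt (.inl hs0) (.inl hst)]
      refine lt_of_not_ge fun hle => (pow_le_pow_left₀ zero_le hle 2).not_gt ?_
      calc (t * s) ^ 2 = t * F * (t * G) := by rw [mul_pow, hs2]; ring
        _ < f x * g y := ENNReal.mul_lt_mul hx hy
        _ ≤ _ := hfgh x y)
  simp only [div_eq_mul_inv] at key
  rw [lintegral_mul_const _ hf, lintegral_mul_const _ hg, lintegral_mul_const _ hh] at key
  set X := ∫⁻ x, f x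
  set Y := ∫⁻ x, g x
  set Z := ∫⁻ x, h x
  have amgm : ∀ a b : ENNReal, 4 * a * b ≤ (a + b) ^ 2 := by
    intro a b
    rcases eq_or_ne a ⊤ with rfl | ha
    · simp
    rcases eq_or_ne b ⊤ with rfl | hb
    · simp
    lift a to NNReal using ha
    lift b to NNReal using hb
    exact_mod_cast four_mul_le_sq_add a b
  have h4 : 4 * (X * F⁻¹) * (Y * G⁻¹) ≤ (2 * (Z * s⁻¹)) ^ 2 :=
    (amgm _ _).trans (pow_le_pow_left₀ zero_le key 2)
  have hinv : (s⁻¹) ^ 2 = F⁻¹ * G⁻¹ := by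
    rw [← ENNReal.inv_pow, hs2, ENNReal.mul_inv (.inl hF0) (.inl hfb)]
  have h5 : 4 * (F⁻¹ * G⁻¹) * (X * Y) ≤ 4 * (F⁻¹ * G⁻¹) * Z ^ 2 := by
    calc _ = 4 * (X * F⁻¹) * (Y * G⁻¹) := by ring
      _ ≤ _ := h4
      _ = 4 * (s⁻¹) ^ 2 * Z ^ 2 := by ring
      _ = _ := by rw [hinv]
  refine (ENNReal.mul_le_mul_iff_right ?_ ?_).1 h5
  · simp [hfb, hgb]
  · exact ENNReal.mul_ne_top (by simp) (ENNReal.mul_ne_top (by simpa) (by simpa))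

/-- Truncating `f` and `g` at integer heights preserves the hypothesis, and monotone convergence
removes the truncation. -/
theorem hasMidpointPrekopaLeindler_real : HasMidpointPrekopaLeindler ℝ := by
  intro f g h hf hg hh hfgh
  have trunc : ∀ u : ℝ → ENNReal, Measurable u →
      ∫⁻ x, u x = ⨆ n : ℕ, ∫⁻ x, min (u x) n := by
    intro u hu
    rw [← lintegral_iSup (fun n => hu.min measurable_const)]
    · refine lintegral_congr fun x => ?_
      rw [← inf_iSup_eq, ENNReal.iSup_natCast, inf_top_eq]
    · intro m n hmn x
      exact min_le_min le_rfl (by exact_mod_cast hmn)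
  have hb : ∀ (u : ℝ → ENNReal) (n : ℕ), ⨆ x, min (u x) n ≠ ⊤ := fun u n =>
    ((iSup_le fun x => min_le_right _ _).trans_lt (ENNReal.natCast_lt_top n)).ne
  rw [trunc f hf, trunc g hg, ENNReal.iSup_mul]
  refine iSup_le fun n => ?_
  rw [ENNReal.mul_iSup]
  refine iSup_le fun m => ?_
  refine prekopa_leindler_real_of_bounded (hf.min measurable_const) (hg.min measurable_const) hh
    (hb f n) (hb g m) fun x y => le_trans ?_ (hfgh x y)
  gcongr <;> exact min_le_left _ _

/-- The inequality on the fibres `F` is exactly the hypothesis, on `E`, for the fibre integrals. -/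
theorem HasMidpointPrekopaLeindler.prod {E F : Type*} [AddCommGroup E] [Module ℝ E]
    [MeasureSpace E] [AddCommGroup F] [Module ℝ F] [MeasureSpace F]
    [SFinite (volume : Measure E)] [SFinite (volume : Measure F)]
    (hE : HasMidpointPrekopaLeindler E) (hF : HasMidpointPrekopaLeindler F) :
    HasMidpointPrekopaLeindler (E × F) := by
  intro f g h hf hg hh hfgh
  rw [Measure.volume_eq_prod, lintegral_prod _ hf.aemeasurable, lintegral_prod _ hg.aemeasurable,
    lintegral_prod _ hh.aemeasurable]
  refine hE _ _ _ hf.lintegral_prod_right' hg.lintegral_prod_right' hh.lintegral_prod_right'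
    fun x y => hF _ _ _ (hf.comp measurable_prodMk_left) (hg.comp measurable_prodMk_left)
      (hh.comp measurable_prodMk_left) fun x' y' => hfgh (x, x') (y, y')

theorem HasMidpointPrekopaLeindler.of_measurePreserving {E F : Type*} [AddCommGroup E] [Module ℝ E]
    [MeasureSpace E] [AddCommGroup F] [Module ℝ F] [MeasureSpace F]
    (hE : HasMidpointPrekopaLeindler E) (e : E ≃ᵐ F) (he : MeasurePreserving e)
    (hmid : ∀ x y, e ((1 / 2 : ℝ) • (x + y)) = (1 / 2 : ℝ) • (e x + e y)) :
    HasMidpointPrekopaLeindler F := by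
  intro f g h hf hg hh hfgh
  rw [← he.lintegral_comp hf, ← he.lintegral_comp hg, ← he.lintegral_comp hh]
  refine hE _ _ _ (hf.comp e.measurable) (hg.comp e.measurable) (hh.comp e.measurable)
    fun x y => ?_
  simpa only [Function.comp_apply, hmid] using hfgh (e x) (e y)

theorem hasMidpointPrekopaLeindler_pi (n : ℕ) : HasMidpointPrekopaLeindler (Fin n → ℝ) := by
  induction n with
  | zero =>
    intro f g h hf hg hh hfgh
    -- The space is a single point with unit mass, so the hypothesis is the conclusion.
    rw [volume_pi, Measure.pi_of_empty, lintegral_dirac, lintegral_dirac, lintegral_dirac]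
    convert hfgh _ _
  | succ n ih =>
    have he := volume_preserving_piFinSuccAbove (fun _ : Fin (n + 1) => ℝ) 0
    set e := MeasurableEquiv.piFinSuccAbove (fun _ : Fin (n + 1) => ℝ) 0
    refine (hasMidpointPrekopaLeindler_real.prod ih).of_measurePreserving e.symm he.symm
      fun x y => ?_
    obtain ⟨x, rfl⟩ := e.surjective x
    obtain ⟨y, rfl⟩ := e.surjective y
    rw [MeasurableEquiv.symm_apply_eq, e.symm_apply_apply, e.symm_apply_apply]
    rfl

/-- Midpoint Prékopa–Leindler inequality in Euclidean space. -/
theorem hasMidpointPrekopaLeindler_euclideanSpace (d : ℕ) :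
    HasMidpointPrekopaLeindler (EuclideanSpace ℝ (Fin d)) :=
  (hasMidpointPrekopaLeindler_pi d).of_measurePreserving
    (MeasurableEquiv.toLp 2 (Fin d → ℝ)) (PiLp.volume_preserving_toLp (Fin d)) fun _ _ => rfl

theorem integral_mul_integral_le_sq_of_midpoint {d : ℕ} {f g h : EuclideanSpace ℝ (Fin d) → ℝ}
    (hf : Integrable f) (hg : Integrable g) (hh : Integrable h)
    (hfc : Continuous f) (hgc : Continuous g) (hhc : Continuous h)
    (hf₀ : 0 ≤ f) (hg₀ : 0 ≤ g) (hh₀ : 0 ≤ h)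
    (hfgh : ∀ x y, f x * g y ≤ h ((1 / 2 : ℝ) • (x + y)) ^ 2) :
    (∫ x, f x) * ∫ x, g x ≤ (∫ x, h x) ^ 2 := by
  have key := hasMidpointPrekopaLeindler_euclideanSpace d (fun x => ENNReal.ofReal (f x))
    (fun x => ENNReal.ofReal (g x)) (fun x => ENNReal.ofReal (h x))
    hfc.measurable.ennreal_ofReal hgc.measurable.ennreal_ofReal hhc.measurable.ennreal_ofReal
    fun x y => by
      rw [← ENNReal.ofReal_mul (hf₀ x), ← ENNReal.ofReal_pow (hh₀ _)]
      exact ENNReal.ofReal_le_ofReal (hfgh x y)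
  rw [← ofReal_integral_eq_lintegral_ofReal hf (ae_of_all _ hf₀),
    ← ofReal_integral_eq_lintegral_ofReal hg (ae_of_all _ hg₀),
    ← ofReal_integral_eq_lintegral_ofReal hh (ae_of_all _ hh₀),
    ← ENNReal.ofReal_mul (integral_nonneg hf₀), ← ENNReal.ofReal_pow (integral_nonneg hh₀)] at key
  exact (ENNReal.ofReal_le_ofReal_iff (sq_nonneg _)).1 key

/-! ### Poincaré inequality for strongly log-concave measures. -/

/-- The derivative of a test function is Lipschitz; `M` is its Lipschitz constant, and the mean
value inequality on a ball of radius `‖h‖` gives the remainder. -/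
theorem exists_le_add_norm_fderiv_mul_norm_add_sq {E : Type*} [NormedAddCommGroup E]
    [NormedSpace ℝ E] {φ : E → ℝ} (hφ : ContDiff ℝ ∞ φ)
    (hs : HasCompactSupport φ) :
    ∃ M : ℝ, 0 ≤ M ∧ ∀ z h, φ (z + h) ≤ φ z + ‖fderiv ℝ φ z‖ * ‖h‖ + M * ‖h‖ ^ 2 := by
  obtain ⟨M, hM⟩ := ContDiff.lipschitzWith_of_hasCompactSupport (hs.fderiv (𝕜 := ℝ))
    (hφ.fderiv_right (m := ∞) (by simp)) (by simp)
  refine ⟨M, M.2, fun z h => ?_⟩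
  have hd : Differentiable ℝ φ := hφ.differentiable (by simp)
  have := (convex_closedBall z ‖h‖).norm_image_sub_le_of_norm_hasFDerivWithin_le'
    (f := φ) (f' := fderiv ℝ φ) (φ := fderiv ℝ φ z) (C := M * ‖h‖) (x := z) (y := z + h)
    (fun x _ => (hd x).hasFDerivAt.hasFDerivWithinAt) (fun x hx => by
      rw [← dist_eq_norm]
      refine (hM.dist_le_mul x z).trans ?_
      exact mul_le_mul_of_nonneg_left (Metric.mem_closedBall.1 hx) M.2)
    (Metric.mem_closedBall_self (norm_nonneg h)) (by simp)
  rw [add_sub_cancel_left, Real.norm_eq_abs] at this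
  have h1 := (abs_le.1 this).2
  have h2 := (Real.le_norm_self _).trans ((fderiv ℝ φ z).le_opNorm h)
  linarith

theorem abs_exp_sub_quadratic_le {x : ℝ} (hx : |x| ≤ 1) :
    |Real.exp x - (1 + x + x ^ 2 / 2)| ≤ |x| ^ 3 := by
  have := Real.exp_bound hx (n := 3) (by norm_num)
  simp only [Finset.sum_range_succ, Finset.sum_range_zero] at this
  norm_num [Nat.factorial] at this
  refine this.trans ?_
  nlinarith [pow_nonneg (abs_nonneg x) 3]

theorem StrongConvexOn.map_half_smul_add_le {E : Type*} [NormedAddCommGroup E] [NormedSpace ℝ E]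
    {c : ℝ} {V : E → ℝ} (hV : StrongConvexOn Set.univ c V) (x y : E) :
    V ((1 / 2 : ℝ) • (x + y)) ≤ (V x + V y) / 2 - c / 8 * ‖x - y‖ ^ 2 := by
  obtain ⟨-, h⟩ := hV
  have := h (Set.mem_univ x) (Set.mem_univ y) (a := 1 / 2) (b := 1 / 2) (by norm_num)
    (by norm_num) (by norm_num)
  rw [← smul_add] at this
  simp only [smul_eq_mul] at this
  linarith

theorem quadratic_sub_le_exp {ε R p : ℝ} (hε : 0 < ε) (hp : |p| ≤ R) (hεR : ε * (2 * R) ≤ 1) :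
    1 - ε ^ 3 * (8 * R ^ 3) + 2 * ε * p + 2 * ε ^ 2 * p ^ 2 ≤ Real.exp (2 * ε * p) := by
  have habs : |2 * ε * p| ≤ 2 * ε * R := by
    rw [abs_mul, abs_of_pos (by positivity : 0 < 2 * ε)]
    gcongr
  have h1 := (abs_le.1 (abs_exp_sub_quadratic_le (habs.trans (by linarith)))).1
  have h2 : |2 * ε * p| ^ 3 ≤ (2 * ε * R) ^ 3 := by gcongr
  have h3 : (2 * ε * R) ^ 3 = ε ^ 3 * (8 * R ^ 3) := by ring
  have h4 : (2 * ε * p) ^ 2 / 2 = 2 * ε ^ 2 * p ^ 2 := by ring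
  linarith

theorem exp_le_quadratic_add {ε A B p u : ℝ} (hε : 0 < ε) (hε1 : ε ≤ 1) (hp : |p| ≤ B)
    (hu : 0 ≤ u) (huA : u ≤ A) (hεR : ε * (B + A) ≤ 1) :
    Real.exp (ε * p + ε ^ 2 * u) ≤
      1 + ε ^ 3 * ((B + A) ^ 2 + (B + A) ^ 3) + ε * p + ε ^ 2 / 2 * p ^ 2 + ε ^ 2 * u := by
  have hB : 0 ≤ B := (abs_nonneg p).trans hp
  have hA : 0 ≤ A := hu.trans huA
  have hε2 : ε ^ 2 ≤ ε := by nlinarith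
  have habs : |ε * p + ε ^ 2 * u| ≤ ε * (B + A) := by
    refine (abs_add_le _ _).trans ?_
    rw [abs_mul, abs_mul, abs_of_pos hε, abs_of_pos (pow_pos hε 2), abs_of_nonneg hu, mul_add]
    gcongr
  have h1 := (abs_le.1 (abs_exp_sub_quadratic_le (habs.trans hεR))).2
  have h2 : |ε * p + ε ^ 2 * u| ^ 3 ≤ (ε * (B + A)) ^ 3 := by gcongr
  have h4 : p * u ≤ B * A := mul_le_mul (abs_le.1 hp).2 huA hu hB
  have h5 : ε ^ 3 * (p * u) ≤ ε ^ 3 * (B * A) := by gcongr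
  have h6 : ε ^ 4 * u ^ 2 ≤ ε ^ 3 * A ^ 2 := by
    have : ε ^ 4 ≤ ε ^ 3 := pow_le_pow_of_le_one hε.le hε1 (by norm_num)
    gcongr
  have h7 : ε ^ 3 * (B * A + A ^ 2 / 2) ≤ ε ^ 3 * (B + A) ^ 2 := by
    gcongr
    nlinarith [mul_nonneg hB hA, sq_nonneg A, sq_nonneg B]
  have h8 : (ε * p + ε ^ 2 * u) ^ 2 / 2 =
      ε ^ 2 / 2 * p ^ 2 + ε ^ 3 * (p * u) + ε ^ 4 * u ^ 2 / 2 := by ring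
  have h9 : (ε * (B + A)) ^ 3 = ε ^ 3 * (B + A) ^ 3 := by ring
  rw [h9] at h2
  rw [h8] at h1
  linarith

/-- Both sides agree to first order in `ε`; divide the difference by `ε ^ 2` and let `ε` tend to
`0`. -/
theorem second_order_coeff_le {Z m q s L : ℝ}
    (h : ∀ᶠ ε : ℝ in nhdsWithin 0 (Set.Ioi 0),
      (Z + 2 * ε * m + 2 * ε ^ 2 * q - ε ^ 3 * L) * Z ≤
        (Z + ε * m + ε ^ 2 * s + ε ^ 3 * L) ^ 2) :
    2 * Z * q ≤ m ^ 2 + 2 * Z * s := by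
  have ht : Filter.Tendsto (fun ε : ℝ => m ^ 2 + 2 * Z * s + (ε * (3 * Z * L + 2 * m * s) +
      ε ^ 2 * (s ^ 2 + 2 * m * L) + 2 * ε ^ 3 * s * L + ε ^ 4 * L ^ 2))
      (nhdsWithin 0 (Set.Ioi 0)) (nhds (m ^ 2 + 2 * Z * s)) := by
    refine Filter.Tendsto.mono_left ?_ nhdsWithin_le_nhds
    refine (Continuous.tendsto' (by fun_prop) _ _ (by simp))
  refine ge_of_tendsto ht ?_
  filter_upwards [h, self_mem_nhdsWithin] with ε hε hpos
  have hpos : 0 < ε := hpos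
  have h2 : 0 < ε ^ 2 := by positivity
  refine le_of_mul_le_mul_left ?_ h2
  nlinarith [hε]

/-- Poincaré inequality for a measure with strongly log-concave density and smooth compactly
supported functions. -/
theorem poincare_of_strongConvexOn {d : ℕ} {V : EuclideanSpace ℝ (Fin d) → ℝ} {c : ℝ}
    (hc : 0 < c) (hV : StrongConvexOn Set.univ c V) (hVc : Continuous V)
    (hint : Integrable fun x => Real.exp (-V x)) {φ : EuclideanSpace ℝ (Fin d) → ℝ}
    (hφ : ContDiff ℝ ∞ φ) (hs : HasCompactSupport φ) :
    (∫ x, Real.exp (-V x)) * (∫ x, φ x ^ 2 * Real.exp (-V x)) -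
        (∫ x, φ x * Real.exp (-V x)) ^ 2 ≤
      2 / c * ((∫ x, Real.exp (-V x)) * ∫ x, ‖fderiv ℝ φ x‖ ^ 2 * Real.exp (-V x)) := by
  have hφc : Continuous φ := hφ.continuous
  have hDc : Continuous (fderiv ℝ φ) := hφ.continuous_fderiv (by simp)
  obtain ⟨B, hB⟩ := hs.exists_bound_of_continuous hφc
  obtain ⟨B', hB'⟩ := (hs.fderiv (𝕜 := ℝ)).exists_bound_of_continuous hDc
  obtain ⟨M, hM0, hM⟩ := exists_le_add_norm_fderiv_mul_norm_add_sq hφ hs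
  have hB0 : 0 ≤ B := (norm_nonneg _).trans (hB 0)
  have hB'0 : 0 ≤ B' := (norm_nonneg _).trans (hB' 0)
  have hint' : ∀ u : EuclideanSpace ℝ (Fin d) → ℝ, Continuous u → (∃ C, ∀ x, ‖u x‖ ≤ C) →
      Integrable fun x => u x * Real.exp (-V x) := by
    rintro u hu ⟨C, hC⟩
    exact hint.bdd_mul hu.aestronglyMeasurable (ae_of_all _ hC)
  -- The second-order correction that lets `exp (2εφ - V)`, `exp (-V)`, `exp (εφ + ε²ψ - V)` satisfy
  -- the midpoint hypothesis.
  let ψ : EuclideanSpace ℝ (Fin d) → ℝ := fun x => ‖fderiv ℝ φ x‖ ^ 2 / c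
  have hψc : Continuous ψ := by fun_prop
  have hψ0 : ∀ x, 0 ≤ ψ x := fun x => by positivity
  have hψB : ∀ x, ψ x ≤ B' ^ 2 / c := fun x => by
    have := hB' x
    simp only [ψ]
    gcongr
  set A := B' ^ 2 / c with hA
  have hA0 : 0 ≤ A := by positivity
  have hφB : ∀ x, |φ x| ≤ B := hB
  set R := B + A with hR
  have hR0 : 0 ≤ R := by positivity
  have hPL : ∀ ε : ℝ, 0 < ε → ε * M ≤ c / 4 →
      (∫ x, Real.exp (2 * ε * φ x) * Real.exp (-V x)) * (∫ x, Real.exp (-V x)) ≤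
        (∫ x, Real.exp (ε * φ x + ε ^ 2 * ψ x) * Real.exp (-V x)) ^ 2 := by
    intro ε hε hεM
    refine integral_mul_integral_le_sq_of_midpoint ?_ hint ?_ (by fun_prop) (by fun_prop)
      (by fun_prop) (fun x => by positivity) (fun x => by positivity) (fun x => by positivity) ?_
    · refine hint' _ (by fun_prop) ⟨Real.exp (2 * ε * B), fun x => ?_⟩
      rw [Real.norm_of_nonneg (Real.exp_pos _).le]
      have := (abs_le.1 (hφB x)).2
      gcongr
    · refine hint' _ (by fun_prop) ⟨Real.exp (ε * B + ε ^ 2 * A), fun x => ?_⟩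
      rw [Real.norm_of_nonneg (Real.exp_pos _).le]
      have := (abs_le.1 (hφB x)).2
      have := hψB x
      gcongr
    · intro x y
      rw [← Real.exp_add, ← Real.exp_add, ← Real.exp_add, sq, ← Real.exp_add]
      refine Real.exp_le_exp.2 ?_
      set z := (1 / 2 : ℝ) • (x + y) with hz
      set h := (1 / 2 : ℝ) • (x - y) with hh
      have hx : x = z + h := by rw [hz, hh]; module
      have hVz := hV.map_half_smul_add_le x y
      rw [← hz] at hVz
      have hhn : ‖x - y‖ = 2 * ‖h‖ := by
        rw [hh, norm_smul]
        norm_num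
        ring
      rw [hhn] at hVz
      have h1 := hM z h
      rw [← hx] at h1
      -- Convexity supplies `c/2 * ‖h‖²` per half of the inequality. One half of it goes to this
      -- Young inequality and the other to the Taylor remainder, whence `2/c` instead of the sharp
      -- `1/c`.
      have h2 : ε * (‖fderiv ℝ φ z‖ * ‖h‖) ≤ ε ^ 2 * ψ z + c / 4 * ‖h‖ ^ 2 := by
        have e1 : ε ^ 2 * ψ z = c * (ε * ‖fderiv ℝ φ z‖ / c) ^ 2 := by
          simp only [ψ]
          field_simp
        have e2 : ε * (‖fderiv ℝ φ z‖ * ‖h‖) = c * (ε * ‖fderiv ℝ φ z‖ / c) * ‖h‖ := by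
          field_simp
        rw [e1, e2]
        nlinarith [mul_nonneg hc.le (sq_nonneg (ε * ‖fderiv ℝ φ z‖ / c - ‖h‖ / 2))]
      have h3 : ε * M * ‖h‖ ^ 2 ≤ c / 4 * ‖h‖ ^ 2 := by gcongr
      have h4 := mul_le_mul_of_nonneg_left h1 hε.le
      linarith
  set Z := ∫ x, Real.exp (-V x) with hZ
  set m := ∫ x, φ x * Real.exp (-V x) with hm
  set q := ∫ x, φ x ^ 2 * Real.exp (-V x) with hq
  set b := ∫ x, ψ x * Real.exp (-V x) with hb
  have hφi : Integrable fun x => φ x * Real.exp (-V x) := hint' _ hφc ⟨B, hB⟩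
  have hqi : Integrable fun x => φ x ^ 2 * Real.exp (-V x) :=
    hint' (fun x => φ x ^ 2) (by fun_prop) ⟨B ^ 2, fun x => by
      rw [norm_pow]
      exact pow_le_pow_left₀ (norm_nonneg _) (hB x) 2⟩
  have hψi : Integrable fun x => ψ x * Real.exp (-V x) :=
    hint' _ hψc ⟨A, fun x => by rw [Real.norm_of_nonneg (hψ0 x)]; exact hψB x⟩
  have hlin : ∀ a₁ a₂ a₃ a₄ : ℝ,
      Integrable (fun x => (a₁ + a₂ * φ x + a₃ * φ x ^ 2 + a₄ * ψ x) * Real.exp (-V x)) ∧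
      ∫ x, (a₁ + a₂ * φ x + a₃ * φ x ^ 2 + a₄ * ψ x) * Real.exp (-V x) =
        a₁ * Z + a₂ * m + a₃ * q + a₄ * b := by
    intro a₁ a₂ a₃ a₄
    have e : (fun x => (a₁ + a₂ * φ x + a₃ * φ x ^ 2 + a₄ * ψ x) * Real.exp (-V x)) =
        fun x => a₁ * Real.exp (-V x) + a₂ * (φ x * Real.exp (-V x)) +
          a₃ * (φ x ^ 2 * Real.exp (-V x)) + a₄ * (ψ x * Real.exp (-V x)) := by
      funext x
      ring
    have i₁ := hint.const_mul a₁
    have i₂ := hφi.const_mul a₂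
    have i₃ := hqi.const_mul a₃
    have i₄ := hψi.const_mul a₄
    rw [e]
    refine ⟨((i₁.add i₂).add i₃).add i₄, ?_⟩
    have j₂ := integral_add i₁ i₂
    have j₃ := integral_add (i₁.add i₂) i₃
    have j₄ := integral_add ((i₁.add i₂).add i₃) i₄
    simp only [Pi.add_apply] at j₃ j₄
    rw [j₄, j₃, j₂, integral_const_mul, integral_const_mul, integral_const_mul,
      integral_const_mul]
  -- Dominates both cubic errors: `8R³` in the lower expansion and `R² + R³` in the upper one.
  set K := R ^ 2 + 8 * R ^ 3
  have hmain : 2 * Z * q ≤ m ^ 2 + 2 * Z * (b + q / 2) := by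
    refine second_order_coeff_le (L := K * Z) ?_
    have hsmall : ∀ a b : ℝ, 0 < b → ∀ᶠ ε : ℝ in nhdsWithin 0 (Set.Ioi 0), ε * a < b := by
      intro a b hb
      have : Filter.Tendsto (fun ε : ℝ => ε * a) (nhdsWithin 0 (Set.Ioi 0)) (nhds 0) :=
        Filter.Tendsto.mono_left (Continuous.tendsto' (by fun_prop) _ _ (by simp))
          nhdsWithin_le_nhds
      exact this.eventually_lt_const hb
    filter_upwards [self_mem_nhdsWithin, hsmall M (c / 4) (by positivity),
      hsmall (2 * R) 1 one_pos, hsmall 1 1 one_pos] with ε hε hεM hεR hε1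
    have hε : 0 < ε := hε
    rw [mul_one] at hε1
    have hFlow : Z + 2 * ε * m + 2 * ε ^ 2 * q - ε ^ 3 * (K * Z) ≤
        ∫ x, Real.exp (2 * ε * φ x) * Real.exp (-V x) := by
      obtain ⟨hi, he⟩ := hlin (1 - ε ^ 3 * K) (2 * ε) (2 * ε ^ 2) 0
      have : Z + 2 * ε * m + 2 * ε ^ 2 * q - ε ^ 3 * (K * Z) =
        (1 - ε ^ 3 * K) * Z + 2 * ε * m + 2 * ε ^ 2 * q + 0 * b := by ring
      rw [this, ← he]
      refine integral_mono hi ?_ fun x => ?_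
      · refine hint' _ (by fun_prop) ⟨Real.exp (2 * ε * B), fun x => ?_⟩
        rw [Real.norm_of_nonneg (Real.exp_pos _).le]
        have := (abs_le.1 (hφB x)).2
        gcongr
      · refine mul_le_mul_of_nonneg_right ?_ (Real.exp_pos _).le
        have h1 := quadratic_sub_le_exp (p := φ x) (R := R) hε ((hφB x).trans (by linarith)) hεR.le
        have h2 : 0 ≤ ε ^ 3 * R ^ 2 := by positivity
        linarith
    have hHup : ∫ x, Real.exp (ε * φ x + ε ^ 2 * ψ x) * Real.exp (-V x) ≤
        Z + ε * m + ε ^ 2 * (b + q / 2) + ε ^ 3 * (K * Z) := by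
      obtain ⟨hi, he⟩ := hlin (1 + ε ^ 3 * K) ε (ε ^ 2 / 2) (ε ^ 2)
      have : Z + ε * m + ε ^ 2 * (b + q / 2) + ε ^ 3 * (K * Z) =
        (1 + ε ^ 3 * K) * Z + ε * m + ε ^ 2 / 2 * q + ε ^ 2 * b := by ring
      rw [this, ← he]
      refine integral_mono ?_ hi fun x => ?_
      · refine hint' _ (by fun_prop) ⟨Real.exp (ε * B + ε ^ 2 * A), fun x => ?_⟩
        rw [Real.norm_of_nonneg (Real.exp_pos _).le]
        have := (abs_le.1 (hφB x)).2
        have := hψB x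
        gcongr
      · refine mul_le_mul_of_nonneg_right ?_ (Real.exp_pos _).le
        have h1 := exp_le_quadratic_add hε hε1.le (hφB x) (hψ0 x) (hψB x)
          (by rw [← hR]; nlinarith)
        have h2 : 0 ≤ ε ^ 3 * R ^ 3 := by positivity
        linarith
    have hH0 : 0 ≤ ∫ x, Real.exp (ε * φ x + ε ^ 2 * ψ x) * Real.exp (-V x) :=
      integral_nonneg fun x => by positivity
    have hZ0 : 0 ≤ Z := integral_nonneg fun x => by positivity
    calc _ ≤ (∫ x, Real.exp (2 * ε * φ x) * Real.exp (-V x)) * Z :=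
          mul_le_mul_of_nonneg_right hFlow hZ0
      _ ≤ _ := hPL ε hε hεM.le
      _ ≤ _ := pow_le_pow_left₀ hH0 hHup 2
  have hbe : b = (∫ x, ‖fderiv ℝ φ x‖ ^ 2 * Real.exp (-V x)) / c := by
    rw [hb, ← integral_div]
    refine integral_congr_ae (ae_of_all _ fun x => ?_)
    simp only [ψ]
    ring
  rw [hbe] at hmain
  have : 2 / c * (Z * ∫ x, ‖fderiv ℝ φ x‖ ^ 2 * Real.exp (-V x)) =
      2 * Z * ((∫ x, ‖fderiv ℝ φ x‖ ^ 2 * Real.exp (-V x)) / c) := by ring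
  rw [this]
  linarith

/-! ### Gibbs measures and bounded perturbations. -/

/-- The measure on Euclidean space with Lebesgue density `exp (-V)`. -/
noncomputable def gibbsMeasure {d : ℕ} (V : EuclideanSpace ℝ (Fin d) → ℝ) :
    Measure (EuclideanSpace ℝ (Fin d)) :=
  volume.withDensity fun x => ENNReal.ofReal (Real.exp (-V x))

section gibbsMeasure

variable {d : ℕ} {V W : EuclideanSpace ℝ (Fin d) → ℝ}

theorem integral_gibbsMeasure (hV : Continuous V) (u : EuclideanSpace ℝ (Fin d) → ℝ) :
    ∫ x, u x ∂gibbsMeasure V = ∫ x, u x * Real.exp (-V x) := by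
  have hm : Measurable fun x => ENNReal.ofReal (Real.exp (-V x)) :=
    (Continuous.measurable (by fun_prop)).ennreal_ofReal
  rw [gibbsMeasure, integral_withDensity_eq_integral_toReal_smul hm (by simp)]
  refine integral_congr_ae (ae_of_all _ fun x => ?_)
  simp only [smul_eq_mul, ENNReal.toReal_ofReal (Real.exp_pos _).le]
  ring

theorem lintegral_gibbsMeasure (hV : Continuous V) {u : EuclideanSpace ℝ (Fin d) → ENNReal}
    (hu : AEMeasurable u) :
    ∫⁻ x, u x ∂gibbsMeasure V = ∫⁻ x, ENNReal.ofReal (Real.exp (-V x)) * u x := by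
  have hm : Measurable fun x => ENNReal.ofReal (Real.exp (-V x)) :=
    (Continuous.measurable (by fun_prop)).ennreal_ofReal
  rw [gibbsMeasure, lintegral_withDensity_eq_lintegral_mul₀ hm.aemeasurable hu]
  rfl

theorem gibbsMeasure_absolutelyContinuous (V : EuclideanSpace ℝ (Fin d) → ℝ) :
    gibbsMeasure V ≪ volume :=
  withDensity_absolutelyContinuous _ _

theorem gibbsMeasure_le (h : ∀ x, V x ≤ W x) : gibbsMeasure W ≤ gibbsMeasure V :=
  withDensity_mono (ae_of_all _ fun x => ENNReal.ofReal_le_ofReal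
    (Real.exp_le_exp.2 (neg_le_neg (h x))))

theorem gibbsMeasure_add_const (V : EuclideanSpace ℝ (Fin d) → ℝ) (a : ℝ) :
    gibbsMeasure (fun x => V x + a) = ENNReal.ofReal (Real.exp (-a)) • gibbsMeasure V := by
  rw [gibbsMeasure, gibbsMeasure, ← withDensity_smul' _ _ ENNReal.ofReal_ne_top]
  congr 1
  funext x
  rw [Pi.smul_apply, smul_eq_mul, ← ENNReal.ofReal_mul (Real.exp_pos _).le, ← Real.exp_add]
  ring_nf

end gibbsMeasure

/-- The variance as a double integral. -/
theorem lintegral_lintegral_sq_sub {α : Type*} [MeasurableSpace α] {ν : Measure α}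
    [IsFiniteMeasure ν] {φ : α → ℝ} (hφ : MemLp φ 2 ν) :
    ∫⁻ x, ∫⁻ y, ENNReal.ofReal ((φ x - φ y) ^ 2) ∂ν ∂ν =
      ENNReal.ofReal (2 * (ν.real Set.univ * ∫ x, φ x ^ 2 ∂ν - (∫ x, φ x ∂ν) ^ 2)) := by
  have h₁ : Integrable φ ν := hφ.integrable (by norm_num)
  have h₂ : Integrable (fun x => φ x ^ 2) ν := hφ.integrable_sq
  set Z := ν.real Set.univ with hZ
  set m := ∫ x, φ x ∂ν
  set q := ∫ x, φ x ^ 2 ∂ν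
  have gen : ∀ a b c : ℝ, Integrable (fun y => a + b * φ y + c * φ y ^ 2) ν ∧
      ∫ y, (a + b * φ y + c * φ y ^ 2) ∂ν = a * Z + b * m + c * q := by
    intro a b c
    have i₀ : Integrable (fun _ => a) ν := integrable_const a
    have i₁ := h₁.const_mul b
    have i₂ := h₂.const_mul c
    have j₁ := integral_add i₀ i₁
    have j₂ := integral_add (i₀.add i₁) i₂
    simp only [Pi.add_apply] at j₂
    refine ⟨(i₀.add i₁).add i₂, ?_⟩
    rw [j₂, j₁, integral_const_mul, integral_const_mul, integral_const, smul_eq_mul, mul_comm a]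
  have inner : ∀ x, ∫⁻ y, ENNReal.ofReal ((φ x - φ y) ^ 2) ∂ν =
      ENNReal.ofReal (q + (-2 * m) * φ x + Z * φ x ^ 2) := by
    intro x
    have e : (fun y => (φ x - φ y) ^ 2) = fun y => φ x ^ 2 + (-2 * φ x) * φ y + 1 * φ y ^ 2 := by
      funext y
      ring
    obtain ⟨hi, he⟩ := gen (φ x ^ 2) (-2 * φ x) 1
    rw [← e] at hi
    rw [← ofReal_integral_eq_lintegral_ofReal hi (ae_of_all _ fun y => sq_nonneg _), e, he]
    congr 1
    ring
  obtain ⟨hi, he⟩ := gen q (-2 * m) Z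
  have hnn : ∀ x, 0 ≤ q + (-2 * m) * φ x + Z * φ x ^ 2 := by
    intro x
    have : q + (-2 * m) * φ x + Z * φ x ^ 2 = ∫ y, (φ x - φ y) ^ 2 ∂ν := by
      obtain ⟨-, he⟩ := gen (φ x ^ 2) (-2 * φ x) 1
      rw [show (fun y => (φ x - φ y) ^ 2) = fun y => φ x ^ 2 + (-2 * φ x) * φ y + 1 * φ y ^ 2 by
        funext y; ring, he]
      ring
    rw [this]
    exact integral_nonneg fun y => sq_nonneg _
  simp only [inner]
  rw [← ofReal_integral_eq_lintegral_ofReal hi (ae_of_all _ hnn), he]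
  congr 1
  ring

/-- Poincaré inequality, on smooth compactly supported functions, for a bounded perturbation of a
strongly log-concave measure. -/
theorem poincare_of_perturbation {d : ℕ} {V W : EuclideanSpace ℝ (Fin d) → ℝ} {c δ : ℝ}
    (hc : 0 < c) (hV : StrongConvexOn Set.univ c V) (hVc : Continuous V)
    (hVW : ∀ x, V x ≤ W x) (hWV : ∀ x, W x ≤ V x + δ)
    [IsProbabilityMeasure (gibbsMeasure W)]
    {φ : EuclideanSpace ℝ (Fin d) → ℝ} (hφ : ContDiff ℝ ∞ φ) (hs : HasCompactSupport φ) :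
    ∫⁻ x, ∫⁻ y, ENNReal.ofReal ((φ x - φ y) ^ 2) ∂gibbsMeasure W ∂gibbsMeasure W ≤
      ENNReal.ofReal (4 / c * Real.exp (2 * δ)) *
        ∫⁻ x, ‖fderiv ℝ φ x‖ₑ ^ 2 ∂gibbsMeasure W := by
  have hle : gibbsMeasure W ≤ gibbsMeasure V := gibbsMeasure_le hVW
  have hge : gibbsMeasure V ≤ ENNReal.ofReal (Real.exp δ) • gibbsMeasure W := by
    have := gibbsMeasure_add_const W (-δ)
    rw [neg_neg] at this
    rw [← this]
    exact gibbsMeasure_le fun x => by linarith [hWV x]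
  have hfin : IsFiniteMeasure (gibbsMeasure V) := by
    have := (gibbsMeasure W).smul_finite (c := ENNReal.ofReal (Real.exp δ)) ENNReal.ofReal_ne_top
    exact isFiniteMeasure_of_le _ hge
  have hint : Integrable fun x => Real.exp (-V x) := by
    refine ⟨(Continuous.aestronglyMeasurable (by fun_prop)), ?_⟩
    rw [hasFiniteIntegral_iff_ofReal (ae_of_all _ fun x => (Real.exp_pos _).le)]
    have := measure_lt_top (gibbsMeasure V) Set.univ
    rwa [gibbsMeasure, withDensity_apply _ MeasurableSet.univ, Measure.restrict_univ] at this
  have hφc : Continuous φ := hφ.continuous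
  have hDc : Continuous (fderiv ℝ φ) := hφ.continuous_fderiv (by simp)
  have hmem : MemLp φ 2 (gibbsMeasure V) := by
    obtain ⟨B, hB⟩ := hs.exists_bound_of_continuous hφc
    exact MemLp.of_bound hφc.aestronglyMeasurable B (ae_of_all _ hB)
  have hDi : Integrable (fun x => ‖fderiv ℝ φ x‖ ^ 2) (gibbsMeasure V) := by
    obtain ⟨B, hB⟩ := (hs.fderiv (𝕜 := ℝ)).exists_bound_of_continuous hDc
    refine Integrable.of_bound (Continuous.aestronglyMeasurable (by fun_prop)) (B ^ 2)
      (ae_of_all _ fun x => ?_)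
    rw [norm_pow, norm_norm]
    exact pow_le_pow_left₀ (norm_nonneg _) (hB x) 2
  have key := poincare_of_strongConvexOn hc hV hVc hint hφ hs
  have hZ : ∫ x, Real.exp (-V x) = (gibbsMeasure V).real Set.univ := by
    have := integral_gibbsMeasure hVc fun _ => 1
    simpa using this.symm
  rw [← integral_gibbsMeasure hVc φ, ← integral_gibbsMeasure hVc (fun x => φ x ^ 2),
    ← integral_gibbsMeasure hVc (fun x => ‖fderiv ℝ φ x‖ ^ 2), hZ] at key
  have hE : ∫⁻ x, ‖fderiv ℝ φ x‖ₑ ^ 2 ∂gibbsMeasure V =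
      ENNReal.ofReal (∫ x, ‖fderiv ℝ φ x‖ ^ 2 ∂gibbsMeasure V) := by
    rw [ofReal_integral_eq_lintegral_ofReal hDi (ae_of_all _ fun x => sq_nonneg _)]
    refine lintegral_congr fun x => ?_
    rw [ENNReal.ofReal_pow (norm_nonneg _), ofReal_norm]
  have hZle : gibbsMeasure V Set.univ ≤ ENNReal.ofReal (Real.exp δ) := by
    refine (hge _).trans_eq ?_
    rw [Measure.smul_apply, measure_univ, smul_eq_mul, mul_one]
  have hEle : ∫⁻ x, ‖fderiv ℝ φ x‖ₑ ^ 2 ∂gibbsMeasure V ≤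
      ENNReal.ofReal (Real.exp δ) * ∫⁻ x, ‖fderiv ℝ φ x‖ₑ ^ 2 ∂gibbsMeasure W := by
    refine (lintegral_mono' hge le_rfl).trans_eq ?_
    rw [lintegral_smul_measure, smul_eq_mul]
  calc ∫⁻ x, ∫⁻ y, ENNReal.ofReal ((φ x - φ y) ^ 2) ∂gibbsMeasure W ∂gibbsMeasure W
      ≤ ∫⁻ x, ∫⁻ y, ENNReal.ofReal ((φ x - φ y) ^ 2) ∂gibbsMeasure V ∂gibbsMeasure V :=
        lintegral_mono' hle fun x => lintegral_mono' hle le_rfl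
    _ = _ := lintegral_lintegral_sq_sub hmem
    _ ≤ ENNReal.ofReal (4 / c * ((gibbsMeasure V).real Set.univ *
          ∫ x, ‖fderiv ℝ φ x‖ ^ 2 ∂gibbsMeasure V)) := by
        refine ENNReal.ofReal_le_ofReal ?_
        refine (mul_le_mul_of_nonneg_left key zero_le_two).trans_eq ?_
        ring
    _ = ENNReal.ofReal (4 / c) * (gibbsMeasure V Set.univ *
          ∫⁻ x, ‖fderiv ℝ φ x‖ₑ ^ 2 ∂gibbsMeasure V) := by
        rw [hE, ENNReal.ofReal_mul (by positivity), ENNReal.ofReal_mul measureReal_nonneg,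
          ofReal_measureReal]
    -- One factor `exp δ` bounds the mass of `gibbsMeasure V`, the other its Dirichlet energy.
    _ ≤ ENNReal.ofReal (4 / c) * (ENNReal.ofReal (Real.exp δ) * (ENNReal.ofReal (Real.exp δ) *
          ∫⁻ x, ‖fderiv ℝ φ x‖ₑ ^ 2 ∂gibbsMeasure W)) := by gcongr
    _ = _ := by
        rw [← mul_assoc, ← mul_assoc, mul_assoc (ENNReal.ofReal (4 / c)),
          ← ENNReal.ofReal_mul (Real.exp_pos _).le, ← Real.exp_add,
          ← ENNReal.ofReal_mul (by positivity), two_mul]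

/-! ### Mollification in weighted spaces. -/

theorem lintegral_mul_sq_le {α : Type*} [MeasurableSpace α] {μ : Measure α} {f g : α → ENNReal}
    (hf : AEMeasurable f μ) (hg : AEMeasurable g μ) :
    (∫⁻ x, f x * g x ∂μ) ^ 2 ≤ (∫⁻ x, f x ∂μ) * ∫⁻ x, f x * g x ^ 2 ∂μ := by
  have h := ENNReal.lintegral_mul_norm_pow_le (μ := μ) (f := f) (g := fun x => f x * g x ^ 2) hf
    (hf.mul (hg.pow_const 2)) (p := 1 / 2) (q := 1 / 2) (by norm_num) (by norm_num) (by norm_num)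
  have e : ∀ x, f x ^ (1 / 2 : ℝ) * (f x * g x ^ 2) ^ (1 / 2 : ℝ) = f x * g x := by
    intro x
    rw [← ENNReal.mul_rpow_of_nonneg _ _ (by norm_num), ← mul_assoc, ← sq, ← mul_pow,
      ← ENNReal.rpow_natCast, ← ENNReal.rpow_mul]
    norm_num
  simp only [e] at h
  refine (pow_le_pow_left₀ zero_le h 2).trans_eq ?_
  rw [← ENNReal.mul_rpow_of_nonneg _ _ (by norm_num), ← ENNReal.rpow_natCast, ← ENNReal.rpow_mul]
  norm_num

section mollification

variable {d : ℕ} {u : EuclideanSpace ℝ (Fin d) → ℝ}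
  {G : EuclideanSpace ℝ (Fin d) → EuclideanSpace ℝ (Fin d)}

/-- Mollification of `u` by the normalized bump function `b`. -/
noncomputable def mollify (b : ContDiffBump (0 : EuclideanSpace ℝ (Fin d)))
    (u : EuclideanSpace ℝ (Fin d) → ℝ) : EuclideanSpace ℝ (Fin d) → ℝ :=
  convolution (b.normed volume) u (ContinuousLinearMap.lsmul ℝ ℝ) volume

theorem contDiff_mollify (b : ContDiffBump (0 : EuclideanSpace ℝ (Fin d)))
    (hu : LocallyIntegrable u) : ContDiff ℝ ∞ (mollify b u) :=
  b.hasCompactSupport_normed.contDiff_convolution_left _ b.contDiff_normed hu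

theorem lintegral_normed_sub (b : ContDiffBump (0 : EuclideanSpace ℝ (Fin d)))
    (x : EuclideanSpace ℝ (Fin d)) :
    ∫⁻ y, ENNReal.ofReal (b.normed volume (x - y)) = 1 := by
  rw [lintegral_sub_left_eq_self (fun z => ENNReal.ofReal (b.normed volume z)) x,
    ← ofReal_integral_eq_lintegral_ofReal b.integrable_normed
      (ae_of_all _ fun z => b.nonneg_normed z), b.integral_normed, ENNReal.ofReal_one]

theorem sq_lintegral_normed_mul_le (b : ContDiffBump (0 : EuclideanSpace ℝ (Fin d)))
    (x : EuclideanSpace ℝ (Fin d)) {f : EuclideanSpace ℝ (Fin d) → ENNReal} (hf : AEMeasurable f) :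
    (∫⁻ y, ENNReal.ofReal (b.normed volume (x - y)) * f y) ^ 2 ≤
      ∫⁻ y, ENNReal.ofReal (b.normed volume (x - y)) * f y ^ 2 := by
  have hb : Continuous (b.normed (volume : Measure (EuclideanSpace ℝ (Fin d)))) :=
    b.continuous_normed
  have hm : Measurable fun y => ENNReal.ofReal (b.normed volume (x - y)) :=
    (Continuous.measurable (by fun_prop)).ennreal_ofReal
  refine (lintegral_mul_sq_le hm.aemeasurable hf).trans_eq ?_
  rw [lintegral_normed_sub, one_mul]

theorem enorm_mollify_sq_le (b : ContDiffBump (0 : EuclideanSpace ℝ (Fin d)))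
    (hu : LocallyIntegrable u) (x : EuclideanSpace ℝ (Fin d)) :
    ‖mollify b u x‖ₑ ^ 2 ≤ ∫⁻ y, ENNReal.ofReal (b.normed volume (x - y)) * ‖u y‖ₑ ^ 2 := by
  refine le_trans (pow_le_pow_left₀ zero_le ?_ 2)
    (sq_lintegral_normed_mul_le b x hu.aestronglyMeasurable.enorm)
  rw [mollify, convolution_eq_swap]
  refine (enorm_integral_le_lintegral_enorm _).trans_eq (lintegral_congr fun y => ?_)
  rw [ContinuousLinearMap.lsmul_apply, enorm_smul,
    Real.enorm_of_nonneg (b.nonneg_normed _)]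

/-- The derivative falls on the kernel, and `y ↦ η (x - y)` is an admissible test function; the sign
of the reflection cancels that of the integration by parts. -/
theorem HasWeakGradient.fderiv_mollify_apply (h : HasWeakGradient u G)
    (b : ContDiffBump (0 : EuclideanSpace ℝ (Fin d))) (x v : EuclideanSpace ℝ (Fin d)) :
    fderiv ℝ (mollify b u) x v = ∫ y, b.normed volume (x - y) * inner ℝ (G y) v := by
  set η := b.normed (volume : Measure (EuclideanSpace ℝ (Fin d))) with hη
  have hηs : HasCompactSupport η := b.hasCompactSupport_normed
  have hηd : ContDiff ℝ ∞ η := b.contDiff_normed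
  have hd := hηs.hasFDerivAt_convolution_left (ContinuousLinearMap.lsmul ℝ ℝ)
    (hηd.of_le (by simp)) h.locallyIntegrable x
  have hex : ConvolutionExistsAt (fderiv ℝ η) u x
      (ContinuousLinearMap.precompL (EuclideanSpace ℝ (Fin d)) (ContinuousLinearMap.lsmul ℝ ℝ))
      volume :=
    (hηs.fderiv (𝕜 := ℝ)).convolutionExists_left _ (hηd.continuous_fderiv (by simp))
      h.locallyIntegrable x
  have hφd : ContDiff ℝ ∞ fun y => η (x - y) := hηd.comp (contDiff_const.sub contDiff_id)
  have hφs : HasCompactSupport fun y => η (x - y) :=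
    hηs.comp_homeomorph (Homeomorph.subLeft x)
  have hder : ∀ y, fderiv ℝ (fun y => η (x - y)) y v = -(fderiv ℝ η (x - y) v) := by
    intro y
    have h1 : HasFDerivAt η (fderiv ℝ η (x - y)) (x - y) :=
      (hηd.differentiable (by simp) _).hasFDerivAt
    have h2 := h1.comp y ((hasFDerivAt_id (𝕜 := ℝ) y).const_sub x)
    rw [HasFDerivAt.fderiv (f := fun y => η (x - y)) h2]
    simp
  have hw := h.integral_eq _ hφd hφs v
  simp only [hder, mul_neg, integral_neg, neg_inj] at hw
  rw [mollify, hd.fderiv, convolution_eq_swap, ContinuousLinearMap.integral_apply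
    hex.integrable_swap, ← hw]
  refine integral_congr_ae (ae_of_all _ fun y => ?_)
  simp [ContinuousLinearMap.precompL_apply, mul_comm]

theorem HasWeakGradient.enorm_fderiv_mollify_sq_le (h : HasWeakGradient u G)
    (b : ContDiffBump (0 : EuclideanSpace ℝ (Fin d))) (x : EuclideanSpace ℝ (Fin d)) :
    ‖fderiv ℝ (mollify b u) x‖ₑ ^ 2 ≤
      ∫⁻ y, ENNReal.ofReal (b.normed volume (x - y)) * ‖G y‖ₑ ^ 2 := by
  refine le_trans (pow_le_pow_left₀ zero_le ?_ 2)
    (sq_lintegral_normed_mul_le b x h.locallyIntegrable_gradient.aestronglyMeasurable.enorm)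
  set η := b.normed (volume : Measure (EuclideanSpace ℝ (Fin d))) with hη
  have hη0 : ∀ z, 0 ≤ η z := b.nonneg_normed
  have hηc : Continuous η := b.continuous_normed
  have hφs : HasCompactSupport fun y => η (x - y) :=
    HasCompactSupport.comp_homeomorph b.hasCompactSupport_normed (Homeomorph.subLeft x)
  have hint : Integrable fun y => η (x - y) • G y :=
    h.locallyIntegrable_gradient.integrable_smul_left_of_hasCompactSupport (by fun_prop) hφs
  have hbound : ‖fderiv ℝ (mollify b u) x‖ ≤ ∫ y, ‖η (x - y) • G y‖ := by
    refine ContinuousLinearMap.opNorm_le_bound _ (integral_nonneg fun _ => norm_nonneg _)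
      fun v => ?_
    rw [h.fderiv_mollify_apply, ← integral_mul_const]
    refine norm_integral_le_of_norm_le (hint.norm.mul_const _) (ae_of_all _ fun y => ?_)
    rw [norm_mul, norm_smul, mul_assoc]
    gcongr
    exact norm_inner_le_norm _ _
  calc ‖fderiv ℝ (mollify b u) x‖ₑ = ENNReal.ofReal ‖fderiv ℝ (mollify b u) x‖ :=
        (ofReal_norm _).symm
    _ ≤ ENNReal.ofReal (∫ y, ‖η (x - y) • G y‖) := ENNReal.ofReal_le_ofReal hbound
    _ = ∫⁻ y, ‖η (x - y) • G y‖ₑ := ofReal_integral_norm_eq_lintegral_enorm hint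
    _ = _ := lintegral_congr fun y => by
        rw [enorm_smul, Real.enorm_of_nonneg (hη0 _)]

/-- Where the kernel is nonzero, `y` is close to `x` and the density at `x` is at most twice that at
`y`; elsewhere both sides vanish. -/
theorem ofReal_exp_mul_normed_le {W : EuclideanSpace ℝ (Fin d) → ℝ}
    (b : ContDiffBump (0 : EuclideanSpace ℝ (Fin d))) {x y : EuclideanSpace ℝ (Fin d)}
    (hosc : dist x y < b.rOut → W y ≤ W x + Real.log 2) :
    ENNReal.ofReal (Real.exp (-W x)) * ENNReal.ofReal (b.normed volume (x - y)) ≤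
      2 * ENNReal.ofReal (Real.exp (-W y)) * ENNReal.ofReal (b.normed volume (x - y)) := by
  by_cases hxy : dist x y < b.rOut
  · refine mul_le_mul_left ?_ _
    have h₁ : (2 : ENNReal) = ENNReal.ofReal (Real.exp (Real.log 2)) := by
      simp [Real.exp_log two_pos]
    rw [h₁, ← ENNReal.ofReal_mul (Real.exp_pos _).le, ← Real.exp_add]
    refine ENNReal.ofReal_le_ofReal (Real.exp_le_exp.2 ?_)
    linarith [hosc hxy]
  · have h0 : x - y ∉ Function.support (b.normed volume) := by
      rw [b.support_normed_eq, Metric.mem_ball, dist_zero_right, ← dist_eq_norm]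
      exact hxy
    simp [Function.notMem_support.1 h0]

/-- Move the density from `x` to `y` at the cost of `C`, then exchange the integrals and use that
the kernel has mass at most `1` in `x`. -/
theorem setLIntegral_mul_lintegral_kernel_le {α : Type*} [MeasurableSpace α] {μ : Measure α}
    [SFinite μ] {ρ f : α → ENNReal} {k : α → α → ENNReal} {B : Set α} {C : ENNReal}
    (hρ : Measurable ρ) (hk : Measurable (Function.uncurry k)) (hf : AEMeasurable f μ)
    (hB : MeasurableSet B) (hle : ∀ x ∈ B, ∀ y, ρ x * k x y ≤ C * ρ y * k x y)
    (hk1 : ∀ y, ∫⁻ x, k x y ∂μ ≤ 1) :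
    ∫⁻ x in B, ρ x * ∫⁻ y, k x y * f y ∂μ ∂μ ≤ C * ∫⁻ y, ρ y * f y ∂μ := by
  calc ∫⁻ x in B, ρ x * ∫⁻ y, k x y * f y ∂μ ∂μ
      ≤ ∫⁻ x in B, ∫⁻ y, C * (ρ y * f y) * k x y ∂μ ∂μ := by
        refine setLIntegral_mono' hB fun x hx => ?_
        have hm : AEMeasurable (fun y => k x y * f y) μ :=
          (hk.comp measurable_prodMk_left).aemeasurable.mul hf
        rw [← lintegral_const_mul'' _ hm]
        refine lintegral_mono fun y => ?_
        calc ρ x * (k x y * f y) = ρ x * k x y * f y := by ring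
          _ ≤ C * ρ y * k x y * f y := mul_le_mul_left (hle x hx y) _
          _ = _ := by ring
    _ ≤ ∫⁻ x, ∫⁻ y, C * (ρ y * f y) * k x y ∂μ ∂μ := setLIntegral_le_lintegral _ _
    _ = ∫⁻ y, ∫⁻ x, C * (ρ y * f y) * k x y ∂μ ∂μ := by
        refine lintegral_lintegral_swap ?_
        exact (((hρ.aemeasurable.mul hf).comp_snd).const_mul C).mul hk.aemeasurable
    _ ≤ ∫⁻ y, C * (ρ y * f y) ∂μ := by
        refine lintegral_mono fun y => ?_
        have hm : Measurable fun x => k x y := hk.comp measurable_prodMk_right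
        rw [lintegral_const_mul _ hm]
        exact mul_le_of_le_one_right zero_le (hk1 y)
    _ = C * ∫⁻ y, ρ y * f y ∂μ := lintegral_const_mul'' _ (hρ.aemeasurable.mul hf)

/-- Averaging over a scale on which the density varies by at most a factor two at most doubles
integrals against the density. -/
theorem setLIntegral_gibbsMeasure_mollify_le {W : EuclideanSpace ℝ (Fin d) → ℝ}
    (hW : Continuous W) {B : Set (EuclideanSpace ℝ (Fin d))} (hB : MeasurableSet B)
    (b : ContDiffBump (0 : EuclideanSpace ℝ (Fin d)))
    (hosc : ∀ x ∈ B, ∀ y, dist x y < b.rOut → W y ≤ W x + Real.log 2)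
    {f : EuclideanSpace ℝ (Fin d) → ENNReal} (hf : AEMeasurable f) :
    ∫⁻ x in B, (∫⁻ y, ENNReal.ofReal (b.normed volume (x - y)) * f y) ∂gibbsMeasure W ≤
      2 * ∫⁻ y, f y ∂gibbsMeasure W := by
  have hb : Continuous (b.normed (volume : Measure (EuclideanSpace ℝ (Fin d)))) :=
    b.continuous_normed
  have hρ : Measurable fun x => ENNReal.ofReal (Real.exp (-W x)) :=
    (Continuous.measurable (by fun_prop)).ennreal_ofReal
  have hk : Measurable (Function.uncurry fun x y : EuclideanSpace ℝ (Fin d) =>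
      ENNReal.ofReal (b.normed volume (x - y))) :=
    (Continuous.measurable (by fun_prop)).ennreal_ofReal
  have hin : AEMeasurable fun x => ∫⁻ y, ENNReal.ofReal (b.normed volume (x - y)) * f y :=
    (hk.aemeasurable.mul hf.comp_snd).lintegral_prod_right'
  have hk1 : ∀ y, ∫⁻ x, ENNReal.ofReal (b.normed volume (x - y)) ≤ 1 := fun y => by
    rw [lintegral_sub_right_eq_self (fun z => ENNReal.ofReal (b.normed volume z)) y,
      ← lintegral_normed_sub b 0,
      lintegral_sub_left_eq_self (fun z => ENNReal.ofReal (b.normed volume z)) 0]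
  have key := setLIntegral_mul_lintegral_kernel_le hρ hk hf hB
    (fun x hx y => ofReal_exp_mul_normed_le b (hosc x hx y)) hk1
  rw [← lintegral_indicator hB, lintegral_gibbsMeasure hW (hin.indicator hB),
    lintegral_gibbsMeasure hW hf]
  refine Eq.trans_le ?_ key
  rw [← lintegral_indicator hB]
  refine lintegral_congr fun x => ?_
  by_cases hx : x ∈ B <;> simp [hx]

end mollification

/-! ### Approximation by test functions and passage to the limit. -/

/-- Smooth cutoff functions of balls of radius `n + 1`, with gradient of order `1 / (n + 1)`. -/
theorem exists_smooth_cutoff (E : Type*) [NormedAddCommGroup E] [InnerProductSpace ℝ E]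
    [FiniteDimensional ℝ E] :
    ∃ (K : ℝ) (χ : ℕ → E → ℝ), ∀ n : ℕ, ContDiff ℝ ∞ (χ n) ∧ HasCompactSupport (χ n) ∧
      (∀ x, ‖χ n x‖ ≤ 1) ∧ (∀ x, ‖x‖ ≤ n + 1 → χ n x = 1) ∧
      (∀ x, x ∉ Metric.closedBall 0 (2 * ((n : ℝ) + 1)) → χ n x = 0 ∧ fderiv ℝ (χ n) x = 0) ∧
      ∀ x, ‖fderiv ℝ (χ n) x‖ ≤ K / (n + 1) := by
  let b : ContDiffBump (0 : E) := ⟨1, 2, one_pos, one_lt_two⟩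
  have hbd : ContDiff ℝ ∞ b := b.contDiff
  obtain ⟨K, hK⟩ := (b.hasCompactSupport.fderiv (𝕜 := ℝ)).exists_bound_of_continuous
    (hbd.continuous_fderiv (by simp))
  refine ⟨K, fun n x => b (((n : ℝ) + 1)⁻¹ • x), fun n => ?_⟩
  have hn : (0 : ℝ) < n + 1 := by positivity
  have hfd : ∀ x, fderiv ℝ (fun x => b (((n : ℝ) + 1)⁻¹ • x)) x =
      ((n : ℝ) + 1)⁻¹ • fderiv ℝ b (((n : ℝ) + 1)⁻¹ • x) := fun x => fderiv_comp_smul _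
  have hnorm : ∀ x : E, ‖((n : ℝ) + 1)⁻¹ • x‖ = ‖x‖ / (n + 1) := by
    intro x
    rw [norm_smul, norm_inv, Real.norm_of_nonneg hn.le]
    ring
  have hout : ∀ x : E, x ∉ Metric.closedBall 0 (2 * ((n : ℝ) + 1)) →
      ((n : ℝ) + 1)⁻¹ • x ∉ tsupport b := by
    intro x hx
    rw [b.tsupport_eq, mem_closedBall_zero_iff, hnorm, not_le, lt_div_iff₀ hn]
    simpa using hx
  refine ⟨hbd.comp (contDiff_const_smul _), ?_, fun x => ?_, fun x hx => ?_, fun x hx => ⟨?_, ?_⟩,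
    fun x => ?_⟩
  · exact b.hasCompactSupport.comp_smul (inv_ne_zero hn.ne')
  · rw [Real.norm_of_nonneg b.nonneg]
    exact b.le_one
  · refine b.one_of_mem_closedBall ?_
    rw [mem_closedBall_zero_iff, hnorm]
    exact (div_le_one hn).2 hx
  · exact image_eq_zero_of_notMem_tsupport (hout x hx)
  · rw [hfd, image_eq_zero_of_notMem_tsupport (f := fderiv ℝ b), smul_zero]
    exact fun h => hout x hx (tsupport_fderiv_subset ℝ h)
  · rw [hfd, norm_smul, norm_inv, Real.norm_of_nonneg hn.le, inv_mul_eq_div]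
    gcongr
    exact hK _

/-- Uniform continuity on the ball of radius `R + 1`; taking `r ≤ 1` keeps `y` inside it. -/
theorem exists_oscillation_radius {E : Type*} [NormedAddCommGroup E] [ProperSpace E] {W : E → ℝ}
    (hW : Continuous W) (R : ℝ) {a : ℝ} (ha : 0 < a) :
    ∃ r > 0, ∀ x ∈ Metric.closedBall (0 : E) R, ∀ y, dist x y < r → W y ≤ W x + a := by
  have huc := (isCompact_closedBall (0 : E) (R + 1)).uniformContinuousOn_of_continuous
    hW.continuousOn
  obtain ⟨r, hr, h⟩ := Metric.uniformContinuousOn_iff.1 huc a ha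
  refine ⟨min r 1, lt_min hr one_pos, fun x hx y hxy => ?_⟩
  have hx' : ‖x‖ ≤ R := mem_closedBall_zero_iff.1 hx
  have hy : ‖y‖ ≤ R + 1 := by
    have h1 : ‖y‖ ≤ ‖x‖ + ‖x - y‖ := by
      have := norm_sub_le x (x - y)
      rwa [sub_sub_cancel] at this
    rw [← dist_eq_norm] at h1
    linarith [lt_min_iff.1 hxy]
  have := h x (mem_closedBall_zero_iff.2 (by linarith)) y (mem_closedBall_zero_iff.2 hy)
    (lt_min_iff.1 hxy).1
  rw [Real.dist_eq] at this
  linarith [(abs_lt.1 this).1]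

theorem ENNReal.add_sq_le_two_mul (a b : ENNReal) : (a + b) ^ 2 ≤ 2 * (a ^ 2 + b ^ 2) := by
  rcases eq_or_ne a ⊤ with rfl | ha
  · simp
  rcases eq_or_ne b ⊤ with rfl | hb
  · simp
  lift a to NNReal using ha
  lift b to NNReal using hb
  have : (a + b) ^ 2 ≤ 2 * (a ^ 2 + b ^ 2) := add_sq_le
  exact_mod_cast this

theorem enorm_smul_add_smul_sq_le {E : Type*} [NormedAddCommGroup E] [NormedSpace ℝ E] {a b : ℝ}
    {x y : E} {k : ENNReal} (ha : ‖a‖ ≤ 1) (hy : ‖y‖ₑ ≤ k) :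
    ‖a • x + b • y‖ₑ ^ 2 ≤ 2 * (‖x‖ₑ ^ 2 + k ^ 2 * ‖b‖ₑ ^ 2) := by
  have ha' : ‖a‖ₑ ≤ 1 := by
    rw [← ofReal_norm, ← ENNReal.ofReal_one]
    exact ENNReal.ofReal_le_ofReal ha
  calc _ ≤ (1 * ‖x‖ₑ + ‖b‖ₑ * k) ^ 2 := by
        refine pow_le_pow_left₀ zero_le ((enorm_add_le _ _).trans ?_) 2
        rw [enorm_smul, enorm_smul]
        gcongr
    _ ≤ _ := ENNReal.add_sq_le_two_mul _ _
    _ = _ := by ring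

section

variable {d : ℕ} {W u : EuclideanSpace ℝ (Fin d) → ℝ}
  {G : EuclideanSpace ℝ (Fin d) → EuclideanSpace ℝ (Fin d)}

/-- Smooth compactly supported functions approximate a weakly differentiable function almost
everywhere, with control of the weighted Dirichlet energy. -/
theorem HasWeakGradient.exists_approximation (h : HasWeakGradient u G) (hW : Continuous W) :
    ∃ (K : ℝ) (φ : ℕ → EuclideanSpace ℝ (Fin d) → ℝ),
      (∀ n, ContDiff ℝ ∞ (φ n) ∧ HasCompactSupport (φ n)) ∧
      (∀ᵐ x, Filter.Tendsto (fun n => φ n x) Filter.atTop (nhds (u x))) ∧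
      ∀ n : ℕ, ∫⁻ x, ‖fderiv ℝ (φ n) x‖ₑ ^ 2 ∂gibbsMeasure W ≤
        4 * ((∫⁻ x, ‖G x‖ₑ ^ 2 ∂gibbsMeasure W) +
          ENNReal.ofReal (K / (n + 1)) ^ 2 * ∫⁻ x, ‖u x‖ₑ ^ 2 ∂gibbsMeasure W) := by
  obtain ⟨K, χ, hχ⟩ := exists_smooth_cutoff (EuclideanSpace ℝ (Fin d))
  -- The mollification scale depends on `n`: on the ball containing the support of the `n`-th
  -- cutoff, `W` must increase by at most `log 2` within that scale.
  choose r hr hosc using fun n : ℕ => exists_oscillation_radius hW (2 * ((n : ℝ) + 1))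
    (Real.log_pos one_lt_two)
  have hs : ∀ n : ℕ, 0 < min (r n) (1 / ((n : ℝ) + 1)) := fun n => lt_min (hr n) (by positivity)
  let b : ℕ → ContDiffBump (0 : EuclideanSpace ℝ (Fin d)) := fun n =>
    ⟨min (r n) (1 / ((n : ℝ) + 1)) / 2, min (r n) (1 / ((n : ℝ) + 1)), half_pos (hs n),
      half_lt_self (hs n)⟩
  have hb0 : Filter.Tendsto (fun n => (b n).rOut) Filter.atTop (nhds 0) :=
    squeeze_zero (fun n => (hs n).le) (fun n => min_le_right _ _)
      tendsto_one_div_add_atTop_nhds_zero_nat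
  have hm : ∀ n, ContDiff ℝ ∞ (mollify (b n) u) := fun n =>
    contDiff_mollify (b n) h.locallyIntegrable
  refine ⟨K, fun n x => χ n x * mollify (b n) u x, fun n => ⟨(hχ n).1.mul (hm n),
    (hχ n).2.1.mul_right⟩, ?_, fun n => ?_⟩
  -- Lebesgue differentiation, for bumps whose outer radius is twice the inner one; the cutoff
  -- equals `1` at a fixed point for large `n`.
  · filter_upwards [ContDiffBump.ae_convolution_tendsto_right_of_locallyIntegrable hb0 (K := 2)
      (.of_forall fun n => (mul_div_cancel₀ _ two_ne_zero).ge) h.locallyIntegrable] with x hx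
    refine hx.congr' ?_
    filter_upwards [Filter.eventually_ge_atTop ⌈‖x‖⌉₊] with n hn
    have : ‖x‖ ≤ n + 1 := (Nat.ceil_le.1 hn).trans (by linarith)
    rw [(hχ n).2.2.2.1 x this, one_mul]
    rfl
  · obtain ⟨hχd, -, hχ1, -, hχ0, hχK⟩ := hχ n
    set k := ENNReal.ofReal (K / (n + 1))
    set B := Metric.closedBall (0 : EuclideanSpace ℝ (Fin d)) (2 * ((n : ℝ) + 1))
    have hfd : ∀ x, fderiv ℝ (fun x => χ n x * mollify (b n) u x) x =
        χ n x • fderiv ℝ (mollify (b n) u) x + mollify (b n) u x • fderiv ℝ (χ n) x := fun x =>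
      fderiv_fun_mul (hχd.differentiable (by simp) x) ((hm n).differentiable (by simp) x)
    have hpt : ∀ x, ‖fderiv ℝ (fun x => χ n x * mollify (b n) u x) x‖ₑ ^ 2 ≤
        B.indicator (fun x => 2 * (‖fderiv ℝ (mollify (b n) u) x‖ₑ ^ 2 +
          k ^ 2 * ‖mollify (b n) u x‖ₑ ^ 2)) x := by
      intro x
      rw [hfd]
      by_cases hx : x ∈ B
      · rw [Set.indicator_of_mem hx]
        have h2 : ‖fderiv ℝ (χ n) x‖ₑ ≤ k := by
          rw [← ofReal_norm]
          exact ENNReal.ofReal_le_ofReal (hχK x)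
        exact enorm_smul_add_smul_sq_le (hχ1 x) h2
      · obtain ⟨h1, h2⟩ := hχ0 x hx
        rw [h1, h2, zero_smul, smul_zero, zero_add, ← ofReal_norm, norm_zero]
        simp
    have hc1 : Continuous (fderiv ℝ (mollify (b n) u)) := (hm n).continuous_fderiv (by simp)
    have hc2 : Continuous (mollify (b n) u) := (hm n).continuous
    have hosc' : ∀ x ∈ B, ∀ y, dist x y < (b n).rOut → W y ≤ W x + Real.log 2 :=
      fun x hx y hxy => hosc n x hx y (hxy.trans_le (min_le_left _ _))
    have hE := (setLIntegral_mono' (μ := gibbsMeasure W) measurableSet_closedBall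
      fun x _ => h.enorm_fderiv_mollify_sq_le (b n) x).trans
      (setLIntegral_gibbsMeasure_mollify_le hW measurableSet_closedBall (b n) hosc'
        (h.locallyIntegrable_gradient.aestronglyMeasurable.enorm.pow_const 2))
    have hS := (setLIntegral_mono' (μ := gibbsMeasure W) measurableSet_closedBall
      fun x _ => enorm_mollify_sq_le (b n) h.locallyIntegrable x).trans
      (setLIntegral_gibbsMeasure_mollify_le hW measurableSet_closedBall (b n) hosc'
        (h.locallyIntegrable.aestronglyMeasurable.enorm.pow_const 2))
    calc _ ≤ ∫⁻ x, B.indicator (fun x => 2 * (‖fderiv ℝ (mollify (b n) u) x‖ₑ ^ 2 +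
          k ^ 2 * ‖mollify (b n) u x‖ₑ ^ 2)) x ∂gibbsMeasure W := lintegral_mono hpt
      _ = 2 * ((∫⁻ x in B, ‖fderiv ℝ (mollify (b n) u) x‖ₑ ^ 2 ∂gibbsMeasure W) +
          k ^ 2 * ∫⁻ x in B, ‖mollify (b n) u x‖ₑ ^ 2 ∂gibbsMeasure W) := by
          have m1 : Measurable fun x => ‖fderiv ℝ (mollify (b n) u) x‖ₑ ^ 2 :=
            hc1.enorm.measurable.pow_const 2
          have m2 : Measurable fun x => ‖mollify (b n) u x‖ₑ ^ 2 :=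
            hc2.enorm.measurable.pow_const 2
          rw [lintegral_indicator measurableSet_closedBall,
            lintegral_const_mul' _ _ (by simp), lintegral_add_left m1, lintegral_const_mul _ m2]
      -- The outer `2` comes from squaring the two-term product rule, the inner ones from the
      -- variation of the density over the mollification scale.
      _ ≤ 2 * (2 * (∫⁻ x, ‖G x‖ₑ ^ 2 ∂gibbsMeasure W) +
          k ^ 2 * (2 * ∫⁻ x, ‖u x‖ₑ ^ 2 ∂gibbsMeasure W)) := by gcongr
      _ = _ := by ring

/-- A Poincaré inequality extends from smooth compactly supported functions to weakly
differentiable functions, up to a factor. -/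
theorem HasWeakGradient.poincare_of_smooth [IsProbabilityMeasure (gibbsMeasure W)]
    (h : HasWeakGradient u G) (hW : Continuous W) {C : ENNReal} (hC : C ≠ ⊤)
    (hP : ∀ φ : EuclideanSpace ℝ (Fin d) → ℝ, ContDiff ℝ ∞ φ → HasCompactSupport φ →
      ∫⁻ x, ∫⁻ y, ENNReal.ofReal ((φ x - φ y) ^ 2) ∂gibbsMeasure W ∂gibbsMeasure W ≤
        C * ∫⁻ x, ‖fderiv ℝ φ x‖ₑ ^ 2 ∂gibbsMeasure W)
    (hu : ∫⁻ x, ‖u x‖ₑ ^ 2 ∂gibbsMeasure W ≠ ⊤) :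
    ∫⁻ x, ∫⁻ y, ENNReal.ofReal ((u x - u y) ^ 2) ∂gibbsMeasure W ∂gibbsMeasure W ≤
      C * (4 * ∫⁻ x, ‖G x‖ₑ ^ 2 ∂gibbsMeasure W) := by
  obtain ⟨K, φ, hφ, hlim, hE⟩ := h.exists_approximation hW
  have hlim' := (gibbsMeasure_absolutelyContinuous W).ae_le hlim
  set p := gibbsMeasure W
  have hφc : ∀ n, Continuous (φ n) := fun n => (hφ n).1.continuous
  have hmeas : ∀ n, Measurable (Function.uncurry fun x y =>
      ENNReal.ofReal ((φ n x - φ n y) ^ 2)) := by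
    intro n
    have := hφc n
    refine Measurable.ennreal_ofReal (Continuous.measurable ?_)
    fun_prop
  have hpt : ∀ᵐ x ∂p, ∫⁻ y, ENNReal.ofReal ((u x - u y) ^ 2) ∂p ≤
      Filter.liminf (fun n => ∫⁻ y, ENNReal.ofReal ((φ n x - φ n y) ^ 2) ∂p) Filter.atTop := by
    filter_upwards [hlim'] with x hx
    refine le_trans (lintegral_mono_ae ?_) (lintegral_liminf_le fun n =>
      (hmeas n).comp measurable_prodMk_left)
    filter_upwards [hlim'] with y hy
    exact (ENNReal.tendsto_ofReal ((hx.sub hy).pow 2)).liminf_eq.ge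
  -- Fatou is used twice, in `y` and then in `x`, so no convergence in `L²` is required.
  have hfatou : ∫⁻ x, ∫⁻ y, ENNReal.ofReal ((u x - u y) ^ 2) ∂p ∂p ≤
      Filter.liminf (fun n => ∫⁻ x, ∫⁻ y, ENNReal.ofReal ((φ n x - φ n y) ^ 2) ∂p ∂p)
        Filter.atTop :=
    (lintegral_mono_ae hpt).trans (lintegral_liminf_le fun n => (hmeas n).lintegral_prod_right')
  have hb : ∀ n : ℕ, ∫⁻ x, ∫⁻ y, ENNReal.ofReal ((φ n x - φ n y) ^ 2) ∂p ∂p ≤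
      C * (4 * ((∫⁻ x, ‖G x‖ₑ ^ 2 ∂p) + ENNReal.ofReal (K / (n + 1)) ^ 2 *
        ∫⁻ x, ‖u x‖ₑ ^ 2 ∂p)) := fun n =>
    (hP _ (hφ n).1 (hφ n).2).trans (mul_le_mul_right (hE n) C)
  refine hfatou.trans ((Filter.liminf_le_liminf (.of_forall hb)).trans (Filter.Tendsto.liminf_eq
    ?_).le)
  have hk : Filter.Tendsto (fun n : ℕ => ENNReal.ofReal (K / (n + 1)) ^ 2 *
      ∫⁻ x, ‖u x‖ₑ ^ 2 ∂p) Filter.atTop (nhds 0) := by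
    have h0 : Filter.Tendsto (fun n : ℕ => K / ((n : ℝ) + 1)) Filter.atTop (nhds 0) := by
      have := (tendsto_one_div_add_atTop_nhds_zero_nat (𝕜 := ℝ)).const_mul K
      simpa [div_eq_mul_inv] using this
    have h1 := ENNReal.Tendsto.pow (n := 2) (ENNReal.tendsto_ofReal h0)
    simpa using ENNReal.Tendsto.mul_const h1 (.inr hu)
  have h3 := ENNReal.Tendsto.const_mul (a := C) (ENNReal.Tendsto.const_mul (a := 4)
    ((tendsto_const_nhds (x := ∫⁻ x, ‖G x‖ₑ ^ 2 ∂p)).add hk) (.inr (by simp))) (.inr hC)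
  simpa using h3

end

/-! ### From Gibbs measures to the Langevin diffusion. -/

theorem StrongConvexOn.continuous {E : Type*} [NormedAddCommGroup E] [NormedSpace ℝ E]
    [FiniteDimensional ℝ E] {c : ℝ} {g : E → ℝ} (hc : 0 ≤ c)
    (hg : StrongConvexOn Set.univ c g) : Continuous g := by
  have := hg.convexOn fun r => by
    simp only [Pi.zero_apply]
    positivity
  exact this.locallyLipschitz.continuous

theorem StrongConvexOn.const_mul_add_const {E : Type*} [NormedAddCommGroup E] [NormedSpace ℝ E]
    {c β : ℝ} {g : E → ℝ} (hg : StrongConvexOn Set.univ c g) (hβ : 0 ≤ β) (a : ℝ) :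
    StrongConvexOn Set.univ (β * c) fun x => β * g x + a := by
  refine ⟨convex_univ, fun x hx y hy s t hs ht hst => ?_⟩
  have h := mul_le_mul_of_nonneg_left (hg.2 hx hy hs ht hst) hβ
  simp only [smul_eq_mul] at h ⊢
  have ha : s * a + t * a = a := by rw [← add_mul, hst, one_mul]
  linarith

/-- The normalizing constant becomes an additive constant in the potential, which affects neither
strong convexity nor the distance to `U`. -/
theorem langevinStationary_eq_gibbsMeasure {d : ℕ} {V : EuclideanSpace ℝ (Fin d) → ℝ}
    (hint : Integrable fun x => Real.exp (-V x)) :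
    langevinStationary V = gibbsMeasure fun x => V x + Real.log (∫ y, Real.exp (-V y)) := by
  have hZ : 0 < ∫ y, Real.exp (-V y) := integral_exp_pos hint
  rw [langevinStationary, Measure.tilted, gibbsMeasure]
  congr 1
  funext x
  rw [neg_add, Real.exp_add, Real.exp_neg (Real.log _), Real.exp_log hZ, div_eq_mul_inv]

/-- Poincaré inequality for Langevin diffusion whose potential is at bounded distance of a
strongly convex function. -/
theorem langevinPoincare_of_strongConvexOn {d : ℕ} {V U : EuclideanSpace ℝ (Fin d) → ℝ} {c δ : ℝ}
    (hc : 0 < c) (hU : StrongConvexOn Set.univ c U) (hVc : Continuous V)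
    (hUV : ∀ x, U x ≤ V x) (hVU : ∀ x, V x ≤ U x + δ)
    (hint : Integrable fun x => Real.exp (-V x)) :
    LangevinPoincare V (8 / c * Real.exp (2 * δ)) := by
  have hprob : IsProbabilityMeasure (langevinStationary V) := isProbabilityMeasure_tilted hint
  have hC : 0 < 8 / c * Real.exp (2 * δ) := by positivity
  refine ⟨hprob, hC, fun u G hu h hG => ?_⟩
  rw [langevinStationary_eq_gibbsMeasure hint] at hprob hu hG ⊢
  set a := Real.log (∫ y, Real.exp (-V y))
  set p := gibbsMeasure fun x => V x + a with hp
  have hUa : StrongConvexOn Set.univ c fun x => U x + a := by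
    simpa using hU.const_mul_add_const zero_le_one a
  have hu2 : Integrable (fun x => u x ^ 2) p := hu.integrable_sq
  have hG2 : Integrable (fun x => ‖G x‖ ^ 2) p := hG.norm.integrable_sq
  have hufin : ∫⁻ x, ‖u x‖ₑ ^ 2 ∂p ≠ ⊤ := by
    have := hu2.2
    simp only [HasFiniteIntegral, enorm_pow] at this
    exact this.ne
  have key := h.poincare_of_smooth (W := fun x => V x + a) (hVc.add continuous_const)
    (C := ENNReal.ofReal (4 / c * Real.exp (2 * δ))) ENNReal.ofReal_ne_top
    (fun φ hφ hs => poincare_of_perturbation hc hUa (hUa.continuous hc.le)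
      (fun x => add_le_add_left (hUV x) a) (fun x => by linarith [hVU x]) hφ hs) hufin
  have hE : ∫⁻ x, ‖G x‖ₑ ^ 2 ∂p = ENNReal.ofReal (∫ x, ‖G x‖ ^ 2 ∂p) := by
    rw [ofReal_integral_eq_lintegral_ofReal hG2 (ae_of_all _ fun x => sq_nonneg _)]
    refine lintegral_congr fun x => ?_
    rw [ENNReal.ofReal_pow (norm_nonneg _), ofReal_norm]
  have hE0 : 0 ≤ ∫ x, ‖G x‖ ^ 2 ∂p := integral_nonneg fun x => sq_nonneg _
  rw [← hp, lintegral_lintegral_sq_sub hu, hE, show (4 : ENNReal) = ENNReal.ofReal 4 by simp,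
    ← ENNReal.ofReal_mul (by norm_num), ← ENNReal.ofReal_mul (by positivity),
    ENNReal.ofReal_le_ofReal_iff (by positivity), probReal_univ, one_mul] at key
  rw [ProbabilityTheory.variance_eq_sub hu, one_div, inv_mul_le_iff₀ hC]
  simp only [Pi.pow_apply]
  -- The double integral is twice the variance, so `4 · 4 / c` becomes `8 / c`.
  have : 4 / c * Real.exp (2 * δ) * (4 * ∫ x, ‖G x‖ ^ 2 ∂p) =
      2 * (8 / c * Real.exp (2 * δ) * ∫ x, ‖G x‖ ^ 2 ∂p) := by ring
  linarith

/-! ### Gaussian tails and the main theorem. -/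

theorem integrable_exp_neg_mul_norm_sq {d : ℕ} {b : ℝ} (hb : 0 < b) :
    Integrable fun x : EuclideanSpace ℝ (Fin d) => Real.exp (-b * ‖x‖ ^ 2) := by
  have h := (GaussianFourier.integrable_cexp_neg_mul_sq_norm_add (V := EuclideanSpace ℝ (Fin d))
    (b := (b : ℂ)) (by simpa) 0 0).norm
  refine h.congr (ae_of_all _ fun x => ?_)
  simp only [Complex.norm_exp]
  congr 1
  rw [zero_mul, add_zero, ← Complex.ofReal_neg, ← Complex.ofReal_pow, ← Complex.ofReal_mul,
    Complex.ofReal_re]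

section mixturePotential

variable {d m : ℕ} {w : Fin m → ℝ} {μ : Fin m → EuclideanSpace ℝ (Fin d)}

theorem mixture_density_pos [Nonempty (Fin m)] (hw : ∀ i, 0 < w i)
    (x : EuclideanSpace ℝ (Fin d)) : 0 < ∑ i, w i * Real.exp (-(‖x - μ i‖ ^ 2 / 2)) :=
  Finset.sum_pos (fun i _ => mul_pos (hw i) (Real.exp_pos _)) Finset.univ_nonempty

theorem continuous_mixturePotential [Nonempty (Fin m)] (hw : ∀ i, 0 < w i) :
    Continuous (mixturePotential w μ) := by
  unfold mixturePotential
  refine (Continuous.log (by fun_prop) fun x => (mixture_density_pos hw x).ne').neg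

/-- From `‖x‖² ≤ 2‖x - μ i‖² + 2D²`, every component is bounded by one centred Gaussian; this yields
integrability of `exp (-β f)`. -/
theorem le_mixturePotential [Nonempty (Fin m)] {D : ℝ} (hw : ∀ i, 0 < w i)
    (hsum : ∑ i, w i = 1) (hμ : ∀ i, ‖μ i‖ ≤ D) (x : EuclideanSpace ℝ (Fin d)) :
    ‖x‖ ^ 2 / 4 - D ^ 2 / 2 ≤ mixturePotential w μ x := by
  rw [mixturePotential, le_neg, Real.log_le_iff_le_exp (mixture_density_pos hw x)]
  calc ∑ i, w i * Real.exp (-(‖x - μ i‖ ^ 2 / 2))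
      ≤ ∑ i, w i * Real.exp (-(‖x‖ ^ 2 / 4 - D ^ 2 / 2)) := by
        refine Finset.sum_le_sum fun i _ => mul_le_mul_of_nonneg_left (Real.exp_le_exp.2 ?_)
          (hw i).le
        have h1 : ‖x‖ ≤ ‖x - μ i‖ + ‖μ i‖ := by
          simpa using norm_add_le (x - μ i) (μ i)
        have h2 : ‖x‖ ^ 2 ≤ (‖x - μ i‖ + D) ^ 2 := by
          have := hμ i
          gcongr
          linarith
        nlinarith [sq_nonneg (‖x - μ i‖ - D)]
    _ = Real.exp (-(‖x‖ ^ 2 / 4 - D ^ 2 / 2)) := by rw [← Finset.sum_mul, hsum, one_mul]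

theorem integrable_exp_neg_mul_mixturePotential [Nonempty (Fin m)] {D β : ℝ} (hw : ∀ i, 0 < w i)
    (hsum : ∑ i, w i = 1) (hμ : ∀ i, ‖μ i‖ ≤ D) (hβ : 0 < β) :
    Integrable fun x => Real.exp (-(β * mixturePotential w μ x)) := by
  have hc := continuous_mixturePotential (μ := μ) hw
  refine ((integrable_exp_neg_mul_norm_sq (d := d) (b := β / 4) (by positivity)).const_mul
    (Real.exp (β * (D ^ 2 / 2)))).mono' (Continuous.aestronglyMeasurable (by fun_prop))
    (ae_of_all _ fun x => ?_)
  rw [Real.norm_of_nonneg (Real.exp_pos _).le, ← Real.exp_add, Real.exp_le_exp]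
  have := mul_le_mul_of_nonneg_left (le_mixturePotential hw hsum hμ x) hβ.le
  linarith

end mixturePotential

theorem lemma8p2 {d m : ℕ} (w : Fin m → ℝ) (μ : Fin m → EuclideanSpace ℝ (Fin d)) (D : ℝ)
    (hw : ∀ i, 0 < w i) (hsum : ∑ i, w i = 1) (hμ : ∀ i, ‖μ i‖ ≤ D) :
    (∃ g : EuclideanSpace ℝ (Fin d) → ℝ,
      (∀ x, stronglyConvexEnvelope (1 / 2) (mixturePotential w μ) x = (g x : EReal)) ∧
      StrongConvexOn Set.univ (1 / 2) g ∧
      ∀ x, |mixturePotential w μ x - g x| ≤ D ^ 2) ∧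
    ∀ β : ℝ, 0 < β →
      LangevinPoincare (fun x => β * mixturePotential w μ x)
        (16 * Real.exp (2 * β * D ^ 2) / β) := by
  have hne : Nonempty (Fin m) := by
    by_contra h
    rw [not_nonempty_iff] at h
    simp at hsum
  obtain ⟨g, hg, hgc, hgf⟩ := exists_mixturePotential_envelope hw hμ
  refine ⟨⟨g, hg, hgc, fun x => abs_le.2 ⟨?_, ?_⟩⟩, fun β hβ => ?_⟩
  · linarith [(hgf x).1, sq_nonneg D]
  · linarith [(hgf x).2]
  -- Scaling by `β` turns modulus `1/2` into `β/2` and distance `D²` into `β D²`.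
  · have h := langevinPoincare_of_strongConvexOn (c := β * (1 / 2)) (δ := β * D ^ 2)
      (V := fun x => β * mixturePotential w μ x) (by positivity)
      (hgc.const_mul_add_const hβ.le 0) ((continuous_mixturePotential hw).const_mul β)
      (fun x => by
        rw [add_zero]
        exact mul_le_mul_of_nonneg_left (hgf x).1 hβ.le)
      (fun x => by linarith [mul_le_mul_of_nonneg_left (hgf x).2 hβ.le])
      (integrable_exp_neg_mul_mixturePotential hw hsum hμ hβ)
    have e : 8 / (β * (1 / 2)) * Real.exp (2 * (β * D ^ 2)) =
        16 * Real.exp (2 * β * D ^ 2) / β := by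
      rw [← mul_assoc 2 β]
      field_simp
      norm_num
    rwa [e] at h
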